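/- **Setting (bipartite degree-corrected stochastic block model).** Let $n,p,K\ge 1$. Workers $i\in\{1,\dots,n\}$ have given types $k_i\in\{1,\dots,K\}$ and firms $j\in\{1,\dots,p\}$ have given types $\ell_j\in\{1,\dots,K\}$; $n_k\ge 1$ is the number of workers of type $k$. Let $\theta_j\ge 0$ with $\sum_{j:\ell_j=\ell}\theta_j=1$ for every $\ell$, and let $C(k,\ell)\ge 0$ be such that $p_{ij}:=\frac1{n_{k_i}}\theta_jC(k_i,\ell_j)\le 1$ for all $i,j$. The entries of the random $n\times p$ matrix $B=(d_{ij})$ are independent, with $d_{ij}\sim\mathrm{Bernoulli}(p_{ij})$; put $\mathfrak B=(p_{ij})$. Write $d_{i\cdot}=\sum_jd_{ij}$, $d_{\cdot j}=\sum_id_{ij}$, $C(k,\cdot)=\sum_\ell C(k,\ell)$, $C(\cdot,\ell)=\sum_kC(k,\ell)$. For ridge parameters $\lambda_w,\lambda_f\ge 0$ let $$D_{w,\lambda}=\mathrm{diag}(d_{i\cdot}+\lambda_w),\quad D_{f,\lambda}=\mathrm{diag}(d_{\cdot j}+\lambda_f),\quad \mathfrak D_{w,\lambda}=\mathrm{diag}\big(\tfrac1{n_{k_i}}C(k_i,\cdot)+\lambda_w\big),\quad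 \mathfrak D_{f,\lambda}=\mathrm{diag}\big(\theta_jC(\cdot,\ell_j)+\lambda_f\big),$$ $$E_\lambda=D_{w,\lambda}^{-1/2}BD_{f,\lambda}^{-1/2},\qquad \mathfrak E_\lambda=\mathfrak D_{w,\lambda}^{-1/2}\mathfrak B\,\mathfrak D_{f,\lambda}^{-1/2},$$ $$L_{f,\lambda}=I_p-E_\lambda^\top E_\lambda,\quad L_{w,\lambda}=I_n-E_\lambda E_\lambda^\top,\quad \mathfrak L_{f,\lambda}=I_p-\mathfrak E_\lambda^\top\mathfrak E_\lambda,\quad \mathfrak L_{w,\lambda}=I_n-\mathfrak E_\lambda\mathfrak E_\lambda^\top .$$ Let $\underline\delta_w=\min_k\frac1{n_k}C(k,\cdot)$ and $\overline\delta_w=\max_k\frac1{n_k}C(k,\cdot)$ be the minimal and maximal expected worker degrees, $\underline\delta_f=\min_j\theta_jC(\cdot,\ell_j)$ and $\overline\delta_f=\max_j\theta_jC(\cdot,\ell_j)$ those of firms, and suppose $\underline\delta_w+\lambda_w>0$ and $\underline\delta_f+\lambda_f>0$. Put $M=\max\{(\underline\delta_w+\lambda_w)^{-1},(\underline\delta_f+\lambda_f)^{-1}\}$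 and $\gamma=p/n$. Norms are spectral norms. **Theorem.** Let $\epsilon>0$ be such that $M\le\big(3\ln\frac{n+p}{\epsilon}\big)^{-1}$ (in particular the right-hand side is defined and positive), and let $t=\sqrt{3M\ln\frac{n+p}{\epsilon}}$. 1. If $\lambda_f>0$, then $\mathfrak L_{f,\lambda}$ is invertible and, with probability at least $1-\frac{3+5\gamma}{1+\gamma}\epsilon$, the matrices $D_{w,\lambda},D_{f,\lambda}$ have positive diagonal entries, $L_{f,\lambda}$ is invertible, and $$\big\|L_{f,\lambda}^{-1}-\mathfrak L_{f,\lambda}^{-1}\big\|\le 16t\left(\frac{\overline\delta_f+\lambda_f}{\lambda_f}\right)^2 .$$ 2. If $\lambda_w>0$, then $\mathfrak L_{w,\lambda}$ is invertible and, with probability at least $1-4\epsilon$, the matrices $D_{w,\lambda},D_{f,\lambda}$ have positive diagonal entries, $L_{w,\lambda}$ is invertible, and $$\big\|L_{w,\lambda}^{-1}-\mathfrak L_{w,\lambda}^{-1}\big\|\le 16t\left(\frac{\overline\delta_w+\lambda_w}{\lambda_w}\right)^2 .$$ -/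

import Mathlib

open MeasureTheory ProbabilityTheory
-- `‖A‖` for a matrix `A` is the spectral norm (operator norm between Euclidean spaces).
open scoped Matrix.Norms.L2Operator

noncomputable section

namespace TwoWay

/-! ### Matrices built from a bipartite (weighted) network -/

/-- `diag(a)^{-1/2} B diag(b)^{-1/2}`. -/
def normalizedAdj {n p : ℕ} (a : Fin n → ℝ) (b : Fin p → ℝ) (B : Matrix (Fin n) (Fin p) ℝ) :
    Matrix (Fin n) (Fin p) ℝ :=
  Matrix.diagonal (fun i => (√(a i))⁻¹) * B * Matrix.diagonal (fun j => (√(b j))⁻¹)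

/-- The normalized Laplacian `I_p - Eᵀ E` on firms. -/
def firmLaplacian {n p : ℕ} (E : Matrix (Fin n) (Fin p) ℝ) : Matrix (Fin p) (Fin p) ℝ :=
  1 - E.transpose * E

/-- The normalized Laplacian `I_n - E Eᵀ` on workers. -/
def workerLaplacian {n p : ℕ} (E : Matrix (Fin n) (Fin p) ℝ) : Matrix (Fin n) (Fin n) ℝ :=
  1 - E * E.transpose

/-- The realized adjacency matrix `B = (d_{ij})`. -/
def adj {n p : ℕ} (d : Fin n → Fin p → ℕ) : Matrix (Fin n) (Fin p) ℝ :=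
  Matrix.of fun i j => (d i j : ℝ)

/-- Regularized worker degrees `d_{i·} + λ_w`, the diagonal of `D_{w,λ}`. -/
def workerDeg {n p : ℕ} (lamw : ℝ) (d : Fin n → Fin p → ℕ) (i : Fin n) : ℝ :=
  ∑ j, (d i j : ℝ) + lamw

/-- Regularized firm degrees `d_{·j} + λ_f`, the diagonal of `D_{f,λ}`. -/
def firmDeg {n p : ℕ} (lamf : ℝ) (d : Fin n → Fin p → ℕ) (j : Fin p) : ℝ :=
  ∑ i, (d i j : ℝ) + lamf

/-- `E_λ = D_{w,λ}^{-1/2} B D_{f,λ}^{-1/2}`. -/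
def Elam {n p : ℕ} (lamw lamf : ℝ) (d : Fin n → Fin p → ℕ) : Matrix (Fin n) (Fin p) ℝ :=
  normalizedAdj (workerDeg lamw d) (firmDeg lamf d) (adj d)

/-- `L_{f,λ} = I_p - E_λᵀ E_λ`. -/
def Lf {n p : ℕ} (lamw lamf : ℝ) (d : Fin n → Fin p → ℕ) : Matrix (Fin p) (Fin p) ℝ :=
  firmLaplacian (Elam lamw lamf d)

/-- `L_{w,λ} = I_n - E_λ E_λᵀ`. -/
def Lw {n p : ℕ} (lamw lamf : ℝ) (d : Fin n → Fin p → ℕ) : Matrix (Fin n) (Fin n) ℝ :=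
  workerLaplacian (Elam lamw lamf d)

/-! ### The degree-corrected stochastic block model -/

/-- The number of workers of type `k`. -/
def typeCount {n K : ℕ} (wtype : Fin n → Fin K) (k : Fin K) : ℕ :=
  (Finset.univ.filter fun i => wtype i = k).card

/-- Parameters of a bipartite degree-corrected stochastic block model with `n` workers, `p` firms
and `K` types on each side; types are given (not random). -/
structure BlockModel (n p K : ℕ) where
  /-- worker types `k_i` -/
  wtype : Fin n → Fin K
  /-- firm types `ℓ_j` -/
  ftype : Fin p → Fin K
  /-- firm degree parameters `θ_j` -/
  θ : Fin p → ℝ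
  /-- affinity matrix `C(k, ℓ)` -/
  C : Fin K → Fin K → ℝ
  typeCount_pos : ∀ k, 0 < typeCount wtype k
  θ_nonneg : ∀ j, 0 ≤ θ j
  θ_sum : ∀ l, ∑ j with ftype j = l, θ j = 1
  C_nonneg : ∀ k l, 0 ≤ C k l
  /-- the edge probabilities are probabilities -/
  prob_le_one : ∀ i j,
    1 / (typeCount wtype (wtype i) : ℝ) * θ j * C (wtype i) (ftype j) ≤ 1

namespace BlockModel

variable {n p K : ℕ}

/-- `p_{ij} = θ_j C(k_i, ℓ_j) / n_{k_i}`. -/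
def prob (S : BlockModel n p K) (i : Fin n) (j : Fin p) : ℝ :=
  1 / (typeCount S.wtype (S.wtype i) : ℝ) * S.θ j * S.C (S.wtype i) (S.ftype j)

theorem prob_mem (S : BlockModel n p K) (i : Fin n) (j : Fin p) :
    S.prob i j ∈ unitInterval :=
  ⟨mul_nonneg (mul_nonneg (by positivity) (S.θ_nonneg j)) (S.C_nonneg _ _), S.prob_le_one i j⟩

/-- The `d_{ij}` are jointly independent, `d_{ij}` having the Bernoulli law with
success probability `p_{ij}`. -/
structure IsNetwork (S : BlockModel n p K) {Ω : Type*} [MeasurableSpace Ω] (μ : Measure Ω)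
    (d : Fin n → Fin p → Ω → ℕ) : Prop where
  indep : iIndepFun (fun ij : Fin n × Fin p => d ij.1 ij.2) μ
  law : ∀ i j, HasLaw (d i j) (bernoulliMeasure 1 0 ⟨S.prob i j, S.prob_mem i j⟩) μ

/-- Expected degree `C(k, ·) / n_k` of a worker of type `k`. -/
def expWorkerDeg (S : BlockModel n p K) (k : Fin K) : ℝ :=
  1 / (typeCount S.wtype k : ℝ) * ∑ l, S.C k l

/-- Expected degree `θ_j C(·, ℓ_j)` of firm `j`. -/
def expFirmDeg (S : BlockModel n p K) (j : Fin p) : ℝ :=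
  S.θ j * ∑ k, S.C k (S.ftype j)

/-- Minimal expected worker degree. -/
def minDegW (S : BlockModel n p K) : ℝ := ⨅ k, S.expWorkerDeg k

/-- Minimal expected firm degree. -/
def minDegF (S : BlockModel n p K) : ℝ := ⨅ j, S.expFirmDeg j

/-- Maximal expected worker degree. -/
def maxDegW (S : BlockModel n p K) : ℝ := ⨆ k, S.expWorkerDeg k

/-- Maximal expected firm degree. -/
def maxDegF (S : BlockModel n p K) : ℝ := ⨆ j, S.expFirmDeg j

/-- The expected adjacency matrix `𝔅 = (p_{ij})`. -/
def expAdj (S : BlockModel n p K) : Matrix (Fin n) (Fin p) ℝ := Matrix.of S.prob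

/-- `𝔈_λ = 𝔇_{w,λ}^{-1/2} 𝔅 𝔇_{f,λ}^{-1/2}`, with `𝔇_{w,λ}`, `𝔇_{f,λ}` the diagonal matrices of
regularized expected degrees. -/
def expElam (S : BlockModel n p K) (lamw lamf : ℝ) : Matrix (Fin n) (Fin p) ℝ :=
  normalizedAdj (fun i => S.expWorkerDeg (S.wtype i) + lamw) (fun j => S.expFirmDeg j + lamf)
    S.expAdj

/-- `𝔏_{f,λ} = I_p - 𝔈_λᵀ 𝔈_λ`. -/
def expLf (S : BlockModel n p K) (lamw lamf : ℝ) : Matrix (Fin p) (Fin p) ℝ :=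
  firmLaplacian (S.expElam lamw lamf)

/-- `𝔏_{w,λ} = I_n - 𝔈_λ 𝔈_λᵀ`. -/
def expLw (S : BlockModel n p K) (lamw lamf : ℝ) : Matrix (Fin n) (Fin n) ℝ :=
  workerLaplacian (S.expElam lamw lamf)

/-- `M = max (M_f, M_w)`, where `M_w`, `M_f` are the inverses of the minimal regularized
expected degrees. -/
def M (S : BlockModel n p K) (lamw lamf : ℝ) : ℝ :=
  max (S.minDegF + lamf)⁻¹ (S.minDegW + lamw)⁻¹

/-- `t = √(3 M ln((n + p) / ε))`. -/
def t (S : BlockModel n p K) (lamw lamf ε : ℝ) : ℝ :=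
  √(3 * S.M lamw lamf * Real.log (((n : ℝ) + p) / ε))

end BlockModel

end TwoWay

end

/-! The ridge makes both inverse Laplacians bounded, so the theorem reduces to comparing the two
normalized adjacency matrices on an event of probability at least 1 - 3ε.

Boundedness is a Schur test: if the rows of `B` sum to at most `a i` and its columns to at most `b j
- l`, with `b j ≤ D`, then the normalized matrix `E` has `‖E‖² ≤ 1 - l / D`, so `I - EᵀE` has an
inverse of norm at most `D / l`. The resolvent identity turns a bound on `‖E - F‖` into one on the
inverses (`norm_firmLaplacian_inv_sub_le`). Passing from realized to expected degrees costs `2t +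
t²`, and centring the edges costs `3t`.

The probabilistic input (`bernProb_compl_goodSet_le`) consists of a scalar Chernoff bound for each
degree and one matrix Chernoff bound. The latter is applied to the signless Laplacian `∑ ξ_ij w_ij
w_ijᵀ` with `w_ij = e_i/√α_i + e_j/√β_j`. Its quadratic form is the bilinear form of the normalized
centred matrix plus diagonal terms given by degree deviations, so an upper bound on its largest
eigenvalue is enough.

The matrix bound (`bernProb_rankOneSum_le`) differentiates `m(θ) = 𝔼 tr exp(θ ∑ ξ_k w_k w_kᵀ)`.
Resampling one edge at a time reduces `m'` to the effect of a rank-one perturbation on `wᵀ exp(·)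
w`, which a double sum over two eigenbases reduces to a scalar inequality for `exp`. A Gronwall
argument then bounds `m`.

With `(n + p) exp(-t²/(3M)) = ε`, the worker and firm degrees together fail with probability at most
2ε, and the matrix bound with probability at most ε. -/

noncomputable section

namespace TwoWay

set_option linter.unusedSectionVars false

/-! ### Finite products of Bernoulli laws -/

section Bernoulli

variable {κ : Type*} [Fintype κ] [DecidableEq κ]

/-- The weight of a configuration under the product of Bernoulli laws with parameters `q`. -/
def bernWeight (q : κ → ℝ) (σ : κ → Bool) : ℝ := ∏ k, if σ k then q k else 1 - q k

/-- Expectation under the product of Bernoulli laws with parameters `q`. -/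
def bernExp (q : κ → ℝ) (f : (κ → Bool) → ℝ) : ℝ := ∑ σ, bernWeight q σ * f σ

open Classical in
/-- Probability under the product of Bernoulli laws with parameters `q`. -/
def bernProb (q : κ → ℝ) (A : Set (κ → Bool)) : ℝ := ∑ σ with σ ∈ A, bernWeight q σ

/-- The centered Bernoulli variable of coordinate `k`. -/
def centered (q : κ → ℝ) (σ : κ → Bool) (k : κ) : ℝ := (if σ k then 1 else 0) - q k

variable {q : κ → ℝ}

theorem bernWeight_nonneg (hq0 : ∀ k, 0 ≤ q k) (hq1 : ∀ k, q k ≤ 1) (σ : κ → Bool) :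
    0 ≤ bernWeight q σ := by
  refine Finset.prod_nonneg fun k _ => ?_
  split_ifs
  · exact hq0 k
  · linarith [hq1 k]

theorem bernExp_prod (q : κ → ℝ) (f : κ → Bool → ℝ) :
    bernExp q (fun σ => ∏ k, f k (σ k)) = ∏ k, (q k * f k true + (1 - q k) * f k false) := by
  have h := Finset.prod_univ_sum (fun _ : κ => (Finset.univ : Finset Bool))
    (fun k b => (if b then q k else 1 - q k) * f k b)
  simp only [Fintype.piFinset_univ, Fintype.sum_bool, Bool.false_eq_true, if_true, if_false] at h
  rw [bernExp]
  simp only [bernWeight, ← Finset.prod_mul_distrib]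
  simpa using h.symm

theorem bernWeight_sum (q : κ → ℝ) : ∑ σ, bernWeight q σ = 1 := by
  simpa [bernExp] using bernExp_prod q (fun _ _ => 1)

theorem bernProb_compl (q : κ → ℝ) (A : Set (κ → Bool)) :
    bernProb q A = 1 - bernProb q Aᶜ := by
  classical
  rw [eq_sub_iff_add_eq, ← bernWeight_sum q]
  simp only [bernProb, Finset.sum_filter, ← Finset.sum_add_distrib]
  refine Finset.sum_congr rfl fun σ _ => ?_
  by_cases h : σ ∈ A <;> simp [h]

theorem bernProb_mono (hq0 : ∀ k, 0 ≤ q k) (hq1 : ∀ k, q k ≤ 1) {A B : Set (κ → Bool)}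
    (h : A ⊆ B) : bernProb q A ≤ bernProb q B := by
  classical
  refine Finset.sum_le_sum_of_subset_of_nonneg ?_ fun σ _ _ => bernWeight_nonneg hq0 hq1 σ
  intro σ
  simpa using fun hσ => h hσ

theorem bernProb_union_le (hq0 : ∀ k, 0 ≤ q k) (hq1 : ∀ k, q k ≤ 1) (A B : Set (κ → Bool)) :
    bernProb q (A ∪ B) ≤ bernProb q A + bernProb q B := by
  classical
  simp only [bernProb, Finset.sum_filter]
  rw [← Finset.sum_add_distrib]
  refine Finset.sum_le_sum fun σ _ => ?_
  have := bernWeight_nonneg hq0 hq1 σ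
  by_cases h1 : σ ∈ A <;> by_cases h2 : σ ∈ B <;> simp [h1, h2, this]

theorem bernProb_iUnion_le {ι : Type*} [Fintype ι] (hq0 : ∀ k, 0 ≤ q k) (hq1 : ∀ k, q k ≤ 1)
    (A : ι → Set (κ → Bool)) : bernProb q (⋃ i, A i) ≤ ∑ i, bernProb q (A i) := by
  classical
  simp only [bernProb, Finset.sum_filter]
  rw [Finset.sum_comm]
  refine Finset.sum_le_sum fun σ _ => ?_
  have hw := bernWeight_nonneg hq0 hq1 σ
  have hnn : ∀ i ∈ Finset.univ, 0 ≤ if σ ∈ A i then bernWeight q σ else 0 := by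
    intro i _; split_ifs <;> simp [hw]
  by_cases h : σ ∈ ⋃ i, A i
  · obtain ⟨i, hi⟩ := Set.mem_iUnion.1 h
    rw [if_pos h]
    simpa [hi] using Finset.single_le_sum hnn (Finset.mem_univ i)
  · rw [if_neg h]
    exact Finset.sum_nonneg hnn

theorem bernExp_mono (hq0 : ∀ k, 0 ≤ q k) (hq1 : ∀ k, q k ≤ 1) {f g : (κ → Bool) → ℝ}
    (h : ∀ σ, f σ ≤ g σ) : bernExp q f ≤ bernExp q g :=
  Finset.sum_le_sum fun σ _ => mul_le_mul_of_nonneg_left (h σ) (bernWeight_nonneg hq0 hq1 σ)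

theorem bernExp_const_mul (c : ℝ) (f : (κ → Bool) → ℝ) :
    bernExp q (fun σ => c * f σ) = c * bernExp q f := by
  simp only [bernExp, Finset.mul_sum]
  exact Finset.sum_congr rfl fun σ _ => by ring

theorem bernExp_sum {ι : Type*} (s : Finset ι) (f : ι → (κ → Bool) → ℝ) :
    bernExp q (fun σ => ∑ i ∈ s, f i σ) = ∑ i ∈ s, bernExp q (f i) := by
  simp only [bernExp, Finset.mul_sum]
  exact Finset.sum_comm

/-- Markov's inequality in exponential form. -/
theorem bernProb_le_exp (hq0 : ∀ k, 0 ≤ q k) (hq1 : ∀ k, q k ≤ 1) {A : Set (κ → Bool)}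
    {f : (κ → Bool) → ℝ} (hf : ∀ σ, 0 ≤ f σ) {a : ℝ} (hA : ∀ σ ∈ A, Real.exp a ≤ f σ) :
    bernProb q A ≤ Real.exp (-a) * bernExp q f := by
  classical
  rw [← bernExp_const_mul]
  simp only [bernProb, Finset.sum_filter, bernExp]
  refine Finset.sum_le_sum fun σ _ => ?_
  have hw := bernWeight_nonneg hq0 hq1 σ
  split_ifs with h
  · refine le_mul_of_one_le_right hw ?_
    calc (1 : ℝ) = Real.exp (-a) * Real.exp a := by rw [← Real.exp_add]; simp
      _ ≤ _ := mul_le_mul_of_nonneg_left (hA σ h) (Real.exp_pos _).le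
  · exact mul_nonneg hw (mul_nonneg (Real.exp_pos _).le (hf σ))

/-- Flipping coordinate `k` is an involution of the cube, and the two updates of `σ` are `σ` and its
flip. -/
theorem sum_update_bool (k : κ) (F : (κ → Bool) → ℝ) :
    ∑ σ, (F (Function.update σ k true) + F (Function.update σ k false)) = 2 * ∑ σ, F σ := by
  have hinv : Function.Involutive fun σ : κ → Bool => Function.update σ k (!σ k) := by
    intro σ; simp
  have h : ∑ σ : κ → Bool, F (Function.update σ k (!σ k)) = ∑ σ, F σ :=
    Equiv.sum_comp hinv.toPerm F
  rw [two_mul]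
  nth_rw 2 [← h]
  rw [← Finset.sum_add_distrib]
  refine Finset.sum_congr rfl fun σ _ => ?_
  have hself : F σ = F (Function.update σ k (σ k)) := by rw [Function.update_eq_self]
  rw [hself]
  cases hk : σ k <;> simp [add_comm]

theorem bernWeight_update (σ : κ → Bool) (k : κ) (b : Bool) :
    bernWeight q (Function.update σ k b) =
      (if b then q k else 1 - q k) *
        ∏ j ∈ Finset.univ.erase k, if σ j then q j else 1 - q j := by
  rw [bernWeight, ← Finset.mul_prod_erase _ _ (Finset.mem_univ k)]
  congr 1
  · simp
  · refine Finset.prod_congr rfl fun j hj => ?_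
    rw [Function.update_of_ne (Finset.ne_of_mem_erase hj)]

/-- Conditioning on all coordinates but `k`. -/
theorem bernExp_resample (k : κ) (f : (κ → Bool) → ℝ) :
    bernExp q f = bernExp q (fun σ =>
      q k * f (Function.update σ k true) + (1 - q k) * f (Function.update σ k false)) := by
  have h1 := sum_update_bool k fun σ => bernWeight q σ * f σ
  have h2 := sum_update_bool k fun σ => bernWeight q σ *
    (q k * f (Function.update σ k true) + (1 - q k) * f (Function.update σ k false))
  simp only [bernWeight_update, Function.update_idem, if_true, Bool.false_eq_true,
    if_false] at h1 h2
  rw [bernExp, bernExp, ← mul_right_inj' (two_ne_zero (α := ℝ)), ← h1, ← h2]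
  exact Finset.sum_congr rfl fun σ _ => by ring

theorem centered_update_self (σ : κ → Bool) (k : κ) (b : Bool) :
    centered q (Function.update σ k b) k = (if b then 1 else 0) - q k := by
  simp [centered]

theorem centered_update_of_ne (σ : κ → Bool) {k j : κ} (h : j ≠ k) (b : Bool) :
    centered q (Function.update σ k b) j = centered q σ j := by
  simp [centered, h]

/-- The cubic Taylor remainder is at most `2/9 |x|³ ≤ 4/27 x²`, and `1/2 + 4/27 < 3/4`. -/
theorem exp_sub_one_sub_le {x : ℝ} (hx : |x| ≤ 2 / 3) :
    Real.exp x - 1 - x ≤ 3 / 4 * x ^ 2 := by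
  have h := Real.exp_bound (x := x) (by linarith) (n := 3) (by norm_num)
  have h' := (abs_le.1 h).2
  simp only [Finset.sum_range_succ, Finset.sum_range_zero, Nat.factorial] at h'
  norm_num at h'
  have : |x| ^ 3 ≤ 2 / 3 * x ^ 2 := by
    rw [← sq_abs x, pow_succ]
    nlinarith [sq_nonneg |x|]
  nlinarith [sq_nonneg x]

/-- Bernstein-type tail bound for weighted sums of centered Bernoulli variables. -/
theorem bernProb_weighted_sum_ge (hq0 : ∀ k, 0 ≤ q k) (hq1 : ∀ k, q k ≤ 1) (c : κ → ℝ)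
    (θ : ℝ) (hθ : 0 ≤ θ) (hθc : ∀ k, |θ * c k| ≤ 2 / 3) (a : ℝ) :
    bernProb q {σ | a ≤ ∑ k, c k * centered q σ k} ≤
      Real.exp (-(θ * a) + 3 / 4 * θ ^ 2 * ∑ k, q k * c k ^ 2) := by
  classical
  refine (bernProb_le_exp hq0 hq1
    (f := fun σ => Real.exp (θ * ∑ k, c k * centered q σ k)) (fun σ => (Real.exp_pos _).le)
    (a := θ * a) fun σ hσ =>
      Real.exp_le_exp.2 (mul_le_mul_of_nonneg_left hσ hθ)).trans ?_
  rw [Real.exp_add]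
  refine mul_le_mul_of_nonneg_left ?_ (Real.exp_pos _).le
  have h := bernExp_prod q fun k b => Real.exp (θ * c k * ((if b then 1 else 0) - q k))
  simp only [← Real.exp_sum] at h
  have e : (fun σ : κ → Bool => Real.exp (θ * ∑ k, c k * centered q σ k)) =
      fun σ => Real.exp (∑ k, θ * c k * ((if σ k then 1 else 0) - q k)) := by
    funext σ
    rw [Finset.mul_sum]
    simp only [centered, mul_assoc]
  rw [e, h, Finset.mul_sum, Real.exp_sum]
  refine Finset.prod_le_prod (fun k _ => ?_) fun k _ => ?_
  · have := hq0 k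
    have : 0 ≤ 1 - q k := by linarith [hq1 k]
    positivity
  · simp only [if_true, Bool.false_eq_true, if_false]
    set x := θ * c k
    have hx := exp_sub_one_sub_le (hθc k)
    have e1 : q k * Real.exp (x * (1 - q k)) + (1 - q k) * Real.exp (x * (0 - q k)) =
        Real.exp (-(x * q k)) * (q k * (Real.exp x - 1) + 1) := by
      have : Real.exp (x * (1 - q k)) = Real.exp (-(x * q k)) * Real.exp x := by
        rw [← Real.exp_add]; congr 1; ring
      rw [this, zero_sub, mul_neg]; ring
    rw [e1]
    -- The moment generating function of a centred Bernoulli variable is dominated by that of a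
    -- centred Poisson variable of the same mean.
    calc Real.exp (-(x * q k)) * (q k * (Real.exp x - 1) + 1)
        ≤ Real.exp (-(x * q k)) * Real.exp (q k * (Real.exp x - 1)) :=
          mul_le_mul_of_nonneg_left (Real.add_one_le_exp _) (Real.exp_pos _).le
      _ = Real.exp (q k * (Real.exp x - 1 - x)) := by
          rw [← Real.exp_add]; congr 1; ring
      _ ≤ _ := Real.exp_le_exp.2 (by
          have := mul_le_mul_of_nonneg_left hx (hq0 k)
          calc _ ≤ _ := this
            _ = 3 / 4 * θ ^ 2 * (q k * c k ^ 2) := by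
              ring)

end Bernoulli

/-! ### A matrix Chernoff bound for sums of rank-one operators -/

section Spectral

/-- This is the trapezoid bound for the convex function `exp`: the logarithmic mean of `exp a` and
`exp b` is at most their arithmetic mean. By symmetry and scaling it reduces to `b = 0 ≤ a`. -/
theorem exp_sub_mul_sub_le (a b : ℝ) :
    (Real.exp a - Real.exp b) * (a - b) ≤ (a - b) ^ 2 * (Real.exp a + Real.exp b) / 2 := by
  have key : ∀ x : ℝ, 0 ≤ x → Real.exp x - 1 ≤ x * (Real.exp x + 1) / 2 := by
    intro x hx
    have hd : ∀ y : ℝ, HasDerivAt (fun y => y * (Real.exp y + 1) / 2 - (Real.exp y - 1))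
        ((1 * (Real.exp y + 1) + y * Real.exp y) / 2 - Real.exp y) y := fun y =>
      (((hasDerivAt_id y).mul ((Real.hasDerivAt_exp y).add_const 1)).div_const 2).sub
        ((Real.hasDerivAt_exp y).sub_const 1)
    have hm : MonotoneOn (fun y => y * (Real.exp y + 1) / 2 - (Real.exp y - 1)) (Set.Ici 0) := by
      refine monotoneOn_of_deriv_nonneg (convex_Ici 0)
        (fun y _ => (hd y).continuousAt.continuousWithinAt)
        (fun y _ => (hd y).differentiableAt.differentiableWithinAt) fun y _ => ?_
      rw [(hd y).deriv]
      have h1 : 1 - y ≤ Real.exp (-y) := by linarith [Real.add_one_le_exp (-y)]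
      have h2 : (1 - y) * Real.exp y ≤ 1 := by
        calc _ ≤ Real.exp (-y) * Real.exp y :=
              mul_le_mul_of_nonneg_right h1 (Real.exp_pos _).le
          _ = 1 := by rw [← Real.exp_add]; simp
      linarith
    have := hm (Set.self_mem_Ici) hx hx
    simp at this
    linarith
  have main : ∀ a b : ℝ, b ≤ a →
      (Real.exp a - Real.exp b) * (a - b) ≤ (a - b) ^ 2 * (Real.exp a + Real.exp b) / 2 := by
    intro a b hab
    have h := key (a - b) (by linarith)
    have hb := Real.exp_pos b
    have e : Real.exp a = Real.exp b * Real.exp (a - b) := by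
      rw [← Real.exp_add]; congr 1; ring
    rw [e]
    have : Real.exp b * (a - b) * (Real.exp (a - b) - 1) ≤
        Real.exp b * (a - b) * ((a - b) * (Real.exp (a - b) + 1) / 2) :=
      mul_le_mul_of_nonneg_left h (mul_nonneg hb.le (by linarith))
    nlinarith
  rcases le_total b a with h | h
  · exact main a b h
  · have := main b a h
    nlinarith

variable {E : Type*} [NormedAddCommGroup E] [InnerProductSpace ℝ E]

/-- Mean value trace inequality for a rank-one perturbation `T = S + θ w wᵀ`, with the trace
functions written in eigenbases `u` of `T` and `v` of `S`. -/
theorem rankOne_trace_exp_le {ι ι' : Type*} [Fintype ι] [Fintype ι']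
    (u : OrthonormalBasis ι ℝ E) (v : OrthonormalBasis ι' ℝ E) (a : ι → ℝ) (b : ι' → ℝ) (w : E)
    {θ : ℝ} (hθ : 0 < θ)
    (h : ∀ i j, (a i - b j) * inner ℝ (u i) (v j) = θ * (inner ℝ (u i) w * inner ℝ (v j) w)) :
    ∑ i, Real.exp (a i) * inner ℝ (u i) w ^ 2 - ∑ j, Real.exp (b j) * inner ℝ (v j) w ^ 2 ≤
      θ * ‖w‖ ^ 2 / 2 * (∑ i, Real.exp (a i) * inner ℝ (u i) w ^ 2 +
        ∑ j, Real.exp (b j) * inner ℝ (v j) w ^ 2) := by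
  have hu : ∀ j, ∑ i, inner ℝ (u i) w * inner ℝ (u i) (v j) = inner ℝ (v j) w := by
    intro j
    rw [← u.sum_inner_mul_inner (v j) w]
    exact Finset.sum_congr rfl fun i _ => by rw [real_inner_comm (u i) (v j), mul_comm]
  have hv : ∀ i, ∑ j, inner ℝ (v j) w * inner ℝ (u i) (v j) = inner ℝ (u i) w := by
    intro i
    rw [← v.sum_inner_mul_inner (u i) w]
    exact Finset.sum_congr rfl fun j _ => by rw [mul_comm]
  -- One factor `⟨u i, w⟩` or `⟨v j, w⟩` is expanded in the other basis; `h` then trades `θ ⟨u i, w⟩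
  -- ⟨v j, w⟩` for an eigenvalue gap. Both sides become double sums with weights `⟨u i, v j⟩²`,
  -- comparable term by term.
  have lhs : θ * (∑ i, Real.exp (a i) * inner ℝ (u i) w ^ 2 -
        ∑ j, Real.exp (b j) * inner ℝ (v j) w ^ 2) =
      ∑ i, ∑ j, (Real.exp (a i) - Real.exp (b j)) * (a i - b j) * inner ℝ (u i) (v j) ^ 2 := by
    have e1 : ∑ i, Real.exp (a i) * inner ℝ (u i) w ^ 2 =
        ∑ i, ∑ j, Real.exp (a i) * inner ℝ (u i) w *
          (inner ℝ (v j) w * inner ℝ (u i) (v j)) := by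
      refine Finset.sum_congr rfl fun i _ => ?_
      rw [← Finset.mul_sum, hv]; ring
    have e2 : ∑ j, Real.exp (b j) * inner ℝ (v j) w ^ 2 =
        ∑ i, ∑ j, Real.exp (b j) * inner ℝ (v j) w *
          (inner ℝ (u i) w * inner ℝ (u i) (v j)) := by
      rw [Finset.sum_comm]
      refine Finset.sum_congr rfl fun j _ => ?_
      rw [← Finset.mul_sum, hu]; ring
    rw [e1, e2]
    simp only [← Finset.sum_sub_distrib, Finset.mul_sum]
    refine Finset.sum_congr rfl fun i _ => Finset.sum_congr rfl fun j _ => ?_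
    linear_combination (-(Real.exp (a i) - Real.exp (b j)) * inner ℝ (u i) (v j)) * h i j
  have rhs : θ ^ 2 * ‖w‖ ^ 2 * (∑ i, Real.exp (a i) * inner ℝ (u i) w ^ 2 +
        ∑ j, Real.exp (b j) * inner ℝ (v j) w ^ 2) =
      ∑ i, ∑ j, ((a i - b j) ^ 2 * (Real.exp (a i) + Real.exp (b j))) *
        inner ℝ (u i) (v j) ^ 2 := by
    have e1 : ‖w‖ ^ 2 * ∑ i, Real.exp (a i) * inner ℝ (u i) w ^ 2 =
        ∑ i, ∑ j, Real.exp (a i) * inner ℝ (u i) w ^ 2 * inner ℝ (v j) w ^ 2 := by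
      rw [Finset.mul_sum]
      refine Finset.sum_congr rfl fun i _ => ?_
      rw [← Finset.mul_sum, v.sum_sq_inner_right]; ring
    have e2 : ‖w‖ ^ 2 * ∑ j, Real.exp (b j) * inner ℝ (v j) w ^ 2 =
        ∑ i, ∑ j, Real.exp (b j) * inner ℝ (v j) w ^ 2 * inner ℝ (u i) w ^ 2 := by
      rw [Finset.mul_sum, Finset.sum_comm]
      refine Finset.sum_congr rfl fun j _ => ?_
      rw [← Finset.mul_sum, u.sum_sq_inner_right]; ring
    rw [mul_assoc, mul_add, e1, e2, ← Finset.sum_add_distrib, Finset.mul_sum]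
    refine Finset.sum_congr rfl fun i _ => ?_
    rw [← Finset.sum_add_distrib, Finset.mul_sum]
    refine Finset.sum_congr rfl fun j _ => ?_
    have := congrArg (· ^ 2) (h i j)
    linear_combination (-(Real.exp (a i) + Real.exp (b j))) * this
  have hle : θ * (∑ i, Real.exp (a i) * inner ℝ (u i) w ^ 2 -
        ∑ j, Real.exp (b j) * inner ℝ (v j) w ^ 2) ≤
      θ ^ 2 * ‖w‖ ^ 2 * (∑ i, Real.exp (a i) * inner ℝ (u i) w ^ 2 +
        ∑ j, Real.exp (b j) * inner ℝ (v j) w ^ 2) / 2 := by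
    rw [lhs, rhs, Finset.sum_div]
    refine Finset.sum_le_sum fun i _ => ?_
    rw [Finset.sum_div]
    refine Finset.sum_le_sum fun j _ => ?_
    have := mul_le_mul_of_nonneg_right (exp_sub_mul_sub_le (a i) (b j))
      (sq_nonneg (inner ℝ (u i) (v j)))
    linarith
  refine le_of_mul_le_mul_left (hle.trans_eq ?_) hθ
  ring

end Spectral

/-! ### Exponential moments of random sums of rank-one operators. -/

section Chernoff

variable {κ : Type*} [Fintype κ] [DecidableEq κ] {q : κ → ℝ}
variable {E : Type*} [NormedAddCommGroup E] [InnerProductSpace ℝ E]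

/-- The operator `∑ ξ_k w_k w_kᵀ`. -/
def rankOneSum (w : κ → E) (ξ : κ → ℝ) : E →ₗ[ℝ] E :=
  ∑ k, ξ k • (innerₛₗ ℝ (w k)).smulRight (w k)

theorem rankOneSum_apply (w : κ → E) (ξ : κ → ℝ) (x : E) :
    rankOneSum w ξ x = ∑ k, ξ k • (inner ℝ (w k) x • w k) := by
  simp [rankOneSum, LinearMap.sum_apply]

theorem inner_rankOneSum (w : κ → E) (ξ : κ → ℝ) (x y : E) :
    inner ℝ y (rankOneSum w ξ x) = ∑ k, ξ k * (inner ℝ (w k) x * inner ℝ (w k) y) := by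
  simp only [rankOneSum_apply, inner_sum, inner_smul_right]
  exact Finset.sum_congr rfl fun k _ => by rw [real_inner_comm (w k) y]

theorem rankOneSum_isSymmetric (w : κ → E) (ξ : κ → ℝ) : (rankOneSum w ξ).IsSymmetric := by
  intro x y
  rw [real_inner_comm, inner_rankOneSum, inner_rankOneSum]
  exact Finset.sum_congr rfl fun k _ => by ring

variable [FiniteDimensional ℝ E]

/-- Eigenvalues of `∑ ξ_k w_k w_kᵀ`. -/
def rankOneEig (w : κ → E) (ξ : κ → ℝ) : Fin (Module.finrank ℝ E) → ℝ :=
  (rankOneSum_isSymmetric w ξ).eigenvalues rfl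

/-- An orthonormal eigenbasis of `∑ ξ_k w_k w_kᵀ`. -/
def rankOneBasis (w : κ → E) (ξ : κ → ℝ) : OrthonormalBasis (Fin (Module.finrank ℝ E)) ℝ E :=
  (rankOneSum_isSymmetric w ξ).eigenvectorBasis rfl

theorem rankOneSum_basis (w : κ → E) (ξ : κ → ℝ) (i : Fin (Module.finrank ℝ E)) :
    rankOneSum w ξ (rankOneBasis w ξ i) = rankOneEig w ξ i • rankOneBasis w ξ i :=
  (rankOneSum_isSymmetric w ξ).apply_eigenvectorBasis rfl i

theorem rankOneEig_eq (w : κ → E) (ξ : κ → ℝ) (i : Fin (Module.finrank ℝ E)) :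
    rankOneEig w ξ i = ∑ k, ξ k * inner ℝ (rankOneBasis w ξ i) (w k) ^ 2 := by
  have h := inner_rankOneSum w ξ (rankOneBasis w ξ i) (rankOneBasis w ξ i)
  rw [rankOneSum_basis, inner_smul_right, real_inner_self_eq_norm_sq,
    (rankOneBasis w ξ).norm_eq_one] at h
  simp only [one_pow, mul_one] at h
  rw [h]
  exact Finset.sum_congr rfl fun k _ => by rw [real_inner_comm]; ring

theorem sum_mul_inner_sq_le_of_eig_le (w : κ → E) (ξ : κ → ℝ) {s : ℝ}
    (h : ∀ i, rankOneEig w ξ i ≤ s) (x : E) :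
    ∑ k, ξ k * inner ℝ (w k) x ^ 2 ≤ s * ‖x‖ ^ 2 := by
  have e : ∑ k, ξ k * inner ℝ (w k) x ^ 2 =
      ∑ i, rankOneEig w ξ i * inner ℝ (rankOneBasis w ξ i) x ^ 2 := by
    calc ∑ k, ξ k * inner ℝ (w k) x ^ 2 = inner ℝ (rankOneSum w ξ x) x := by
          rw [real_inner_comm, inner_rankOneSum]
          exact Finset.sum_congr rfl fun k _ => by ring
      _ = _ := by
          rw [← (rankOneBasis w ξ).sum_inner_mul_inner]
          refine Finset.sum_congr rfl fun i _ => ?_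
          rw [rankOneSum_isSymmetric w ξ, rankOneSum_basis, inner_smul_right,
            real_inner_comm x]
          ring
  rw [e, ← (rankOneBasis w ξ).sum_sq_inner_right x, Finset.mul_sum]
  exact Finset.sum_le_sum fun i _ => mul_le_mul_of_nonneg_right (h i) (sq_nonneg _)

/-- `wᵀ exp(θ ∑ ξ_k w_k w_kᵀ) w`. -/
def expForm (w : κ → E) (θ : ℝ) (ξ : κ → ℝ) (x : E) : ℝ :=
  ∑ i, Real.exp (θ * rankOneEig w ξ i) * inner ℝ (rankOneBasis w ξ i) x ^ 2

/-- `tr exp(θ ∑ ξ_k w_k w_kᵀ)`. -/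
def expTrace (w : κ → E) (θ : ℝ) (ξ : κ → ℝ) : ℝ := ∑ i, Real.exp (θ * rankOneEig w ξ i)

theorem expForm_nonneg (w : κ → E) (θ : ℝ) (ξ : κ → ℝ) (x : E) : 0 ≤ expForm w θ ξ x :=
  Finset.sum_nonneg fun _ _ => mul_nonneg (Real.exp_pos _).le (sq_nonneg _)

theorem expTrace_nonneg (w : κ → E) (θ : ℝ) (ξ : κ → ℝ) : 0 ≤ expTrace w θ ξ :=
  Finset.sum_nonneg fun _ _ => (Real.exp_pos _).le

/-- The two operators differ by exactly `w_k w_kᵀ`; pairing the difference with one eigenvector of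
each operator gives the hypothesis of `rankOne_trace_exp_le`. -/
theorem expForm_sub_le (w : κ → E) {θ : ℝ} (hθ : 0 < θ) (ξ ξ' : κ → ℝ) (k : κ)
    (hk : ξ k - ξ' k = 1) (hne : ∀ j ≠ k, ξ j = ξ' j) :
    expForm w θ ξ (w k) - expForm w θ ξ' (w k) ≤
      θ * ‖w k‖ ^ 2 / 2 * (expForm w θ ξ (w k) + expForm w θ ξ' (w k)) := by
  refine rankOne_trace_exp_le (rankOneBasis w ξ) (rankOneBasis w ξ') _ _ (w k) hθ fun i j => ?_
  have h1 := rankOneSum_isSymmetric w ξ (rankOneBasis w ξ i) (rankOneBasis w ξ' j)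
  have h2 : inner ℝ (rankOneBasis w ξ i) (rankOneSum w ξ' (rankOneBasis w ξ' j)) =
      rankOneEig w ξ' j * inner ℝ (rankOneBasis w ξ i) (rankOneBasis w ξ' j) := by
    rw [rankOneSum_basis, inner_smul_right]
  rw [rankOneSum_basis, inner_smul_left, inner_rankOneSum] at h1
  rw [inner_rankOneSum] at h2
  have h3 : ∑ l, ξ l * (inner ℝ (w l) (rankOneBasis w ξ' j) * inner ℝ (w l) (rankOneBasis w ξ i)) -
      ∑ l, ξ' l * (inner ℝ (w l) (rankOneBasis w ξ' j) * inner ℝ (w l) (rankOneBasis w ξ i)) =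
      inner ℝ (w k) (rankOneBasis w ξ' j) * inner ℝ (w k) (rankOneBasis w ξ i) := by
    rw [← Finset.sum_sub_distrib, Finset.sum_eq_single k]
    · rw [← sub_mul, hk, one_mul]
    · intro l _ hl
      rw [hne l hl, sub_self]
    · simp
  rw [real_inner_comm (w k) (rankOneBasis w ξ i), real_inner_comm (w k) (rankOneBasis w ξ' j)]
  simp only [conj_trivial] at h1
  linear_combination θ * h1 + θ * h2 + θ * h3

/-- The moment generating function of the centered random operator has logarithmic derivative
controlled by the mean of the uncentered one. -/
theorem bernExp_centered_expForm_le (hq0 : ∀ k, 0 ≤ q k) (hq1 : ∀ k, q k ≤ 1) (w : κ → E)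
    {θ ρ : ℝ} (hθ : 0 < θ) (hρ : ρ < 1) (k : κ) (hw : θ * ‖w k‖ ^ 2 / 2 ≤ ρ) :
    bernExp q (fun σ => centered q σ k * expForm w θ (centered q σ) (w k)) ≤
      2 * ρ / (1 - ρ) * (q k * bernExp q fun σ => expForm w θ (centered q σ) (w k)) := by
  rw [bernExp_resample k, bernExp_resample (q := q) k fun σ => expForm w θ (centered q σ) (w k),
    ← bernExp_const_mul, ← bernExp_const_mul]
  refine bernExp_mono hq0 hq1 fun σ => ?_
  simp only [centered_update_self, if_true, Bool.false_eq_true, if_false]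
  have h := expForm_sub_le w hθ (centered q (Function.update σ k true))
    (centered q (Function.update σ k false)) k (by simp [centered_update_self]) fun j hj => by
      rw [centered_update_of_ne σ hj, centered_update_of_ne σ hj]
  have hu := expForm_nonneg w θ (centered q (Function.update σ k true)) (w k)
  have hv := expForm_nonneg w θ (centered q (Function.update σ k false)) (w k)
  set u := expForm w θ (centered q (Function.update σ k true)) (w k)
  set v := expForm w θ (centered q (Function.update σ k false)) (w k)
  have hρ0 : 0 ≤ ρ := le_trans (by positivity) hw
  have h1 : u - v ≤ ρ * (u + v) :=
    h.trans (mul_le_mul_of_nonneg_right hw (add_nonneg hu hv))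
  -- Solving `h1` for `u` gives `(1 - ρ) u ≤ (1 + ρ) v`.
  have h2 : u - v ≤ 2 * ρ / (1 - ρ) * v := by
    rw [div_mul_eq_mul_div, le_div_iff₀ (by linarith)]
    linarith
  have hc : 0 ≤ 2 * ρ / (1 - ρ) := div_nonneg (by linarith) (by linarith)
  have hk0 := hq0 k
  have hk1 : 0 ≤ 1 - q k := by linarith [hq1 k]
  -- Centring leaves only the difference `u - v`; the nonnegative term `q k * u` is added back at
  -- the end to recover the full mean.
  calc q k * ((1 - q k) * u) + (1 - q k) * ((0 - q k) * v)
      = q k * (1 - q k) * (u - v) := by ring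
    _ ≤ q k * (1 - q k) * (2 * ρ / (1 - ρ) * v) :=
        mul_le_mul_of_nonneg_left h2 (mul_nonneg hk0 hk1)
    _ = 2 * ρ / (1 - ρ) * (q k * ((1 - q k) * v)) := by ring
    _ ≤ 2 * ρ / (1 - ρ) * (q k * (q k * u + (1 - q k) * v)) := by
        gcongr
        linarith [mul_nonneg hk0 hu]

/-- The eigenbasis does not depend on `θ`, so only the scalar exponentials are differentiated; each
eigenvalue is then expanded as a Rayleigh quotient. -/
theorem hasDerivAt_expTrace (w : κ → E) (ξ : κ → ℝ) (θ : ℝ) :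
    HasDerivAt (fun θ => expTrace w θ ξ) (∑ k, ξ k * expForm w θ ξ (w k)) θ := by
  have e : ∑ k, ξ k * expForm w θ ξ (w k) =
      ∑ i, Real.exp (θ * rankOneEig w ξ i) * (1 * rankOneEig w ξ i) := by
    simp only [expForm, Finset.mul_sum, one_mul]
    rw [Finset.sum_comm]
    refine Finset.sum_congr rfl fun i _ => ?_
    refine Eq.trans ?_ (congrArg (Real.exp (θ * rankOneEig w ξ i) * ·) (rankOneEig_eq w ξ i).symm)
    rw [Finset.mul_sum]
    exact Finset.sum_congr rfl fun k _ => by ring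
  rw [e]
  exact HasDerivAt.fun_sum fun i _ => ((hasDerivAt_id θ).mul_const (rankOneEig w ξ i)).exp

theorem hasDerivAt_bernExp_expTrace (w : κ → E) (θ : ℝ) :
    HasDerivAt (fun θ => bernExp q fun σ => expTrace w θ (centered q σ))
      (∑ k, bernExp q fun σ => centered q σ k * expForm w θ (centered q σ) (w k)) θ := by
  rw [← bernExp_sum]
  exact HasDerivAt.fun_sum fun σ _ =>
    (hasDerivAt_expTrace w (centered q σ) θ).const_mul (bernWeight q σ)

/-- The variance bound `hV`, applied to each eigenvector, closes the differential inequality: the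
derivative is bounded by the trace itself. -/
theorem sum_mul_expForm_le (w : κ → E) {V : ℝ}
    (hV : ∀ x : E, ∑ k, q k * inner ℝ (w k) x ^ 2 ≤ V * ‖x‖ ^ 2) (θ : ℝ) (ξ : κ → ℝ) :
    ∑ k, q k * expForm w θ ξ (w k) ≤ V * expTrace w θ ξ := by
  simp only [expForm, expTrace, Finset.mul_sum]
  rw [Finset.sum_comm]
  refine Finset.sum_le_sum fun i _ => ?_
  have h := mul_le_mul_of_nonneg_left (hV (rankOneBasis w ξ i))
    (Real.exp_pos (θ * rankOneEig w ξ i)).le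
  rw [(rankOneBasis w ξ).norm_eq_one, one_pow, mul_one, Finset.mul_sum] at h
  rw [mul_comm V]
  refine le_trans (le_of_eq (Finset.sum_congr rfl fun k _ => ?_)) h
  rw [real_inner_comm (w k)]
  ring

/-- Gronwall: `m' (y) ≤ 2 c y m (y)` on `(0, θ)` makes `m (y) exp (-c y²)` nonincreasing, and `m 0`
is the dimension. -/
theorem bernExp_expTrace_le (hq0 : ∀ k, 0 ≤ q k) (hq1 : ∀ k, q k ≤ 1) (w : κ → E) {R V : ℝ}
    (hV0 : 0 ≤ V) (hR : ∀ k, ‖w k‖ ^ 2 ≤ R) (hR0 : 0 ≤ R)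
    (hV : ∀ x : E, ∑ k, q k * inner ℝ (w k) x ^ 2 ≤ V * ‖x‖ ^ 2) {θ : ℝ} (hθ : 0 ≤ θ)
    (hθR : θ * R / 2 < 1) :
    (bernExp q fun σ => expTrace w θ (centered q σ)) ≤
      Module.finrank ℝ E * Real.exp (V * R * θ ^ 2 / (2 * (1 - θ * R / 2))) := by
  set m : ℝ → ℝ := fun θ => bernExp q fun σ => expTrace w θ (centered q σ)
  -- The denominator is frozen at the endpoint `θ`, its smallest value on the interval, so that `c`
  -- is constant.
  set c : ℝ := V * R / (2 * (1 - θ * R / 2))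
  have hm0 : m 0 = Module.finrank ℝ E := by
    simp [m, expTrace, bernExp, ← Finset.sum_mul, bernWeight_sum]
  have hmnn : ∀ x, 0 ≤ m x := fun x =>
    Finset.sum_nonneg fun σ _ => mul_nonneg (bernWeight_nonneg hq0 hq1 σ) (expTrace_nonneg _ _ _)
  have hd : ∀ x, HasDerivAt (fun x => m x * Real.exp (-(c * x ^ 2))) _ x := fun x =>
    (hasDerivAt_bernExp_expTrace w x).mul ((((hasDerivAt_id x).pow 2).const_mul c).neg.exp)
  have hanti : AntitoneOn (fun x => m x * Real.exp (-(c * x ^ 2))) (Set.Icc 0 θ) := by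
    refine antitoneOn_of_deriv_nonpos (convex_Icc 0 θ)
      (fun y _ => (hd y).continuousAt.continuousWithinAt)
      (fun y _ => (hd y).differentiableAt.differentiableWithinAt) fun y hy => ?_
    rw [interior_Icc] at hy
    rw [(hd y).deriv]
    have hρ : y * R / 2 ≤ θ * R / 2 := by nlinarith [hy.2]
    have hρ0 : 0 ≤ y * R / 2 := by have := hy.1; positivity
    have key : (∑ k, bernExp q fun σ => centered q σ k * expForm w y (centered q σ) (w k)) ≤
        2 * c * y * m y := by
      calc (∑ k, bernExp q fun σ => centered q σ k * expForm w y (centered q σ) (w k))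
          ≤ ∑ k, 2 * (y * R / 2) / (1 - y * R / 2) *
              (q k * bernExp q fun σ => expForm w y (centered q σ) (w k)) :=
            Finset.sum_le_sum fun k _ =>
              bernExp_centered_expForm_le hq0 hq1 w hy.1 (by linarith) k (by
                have := mul_le_mul_of_nonneg_left (hR k) hy.1.le
                linarith)
        _ = 2 * (y * R / 2) / (1 - y * R / 2) *
              bernExp q fun σ => ∑ k, q k * expForm w y (centered q σ) (w k) := by
            rw [← Finset.mul_sum, bernExp_sum]
            simp only [bernExp_const_mul]
        _ ≤ 2 * (y * R / 2) / (1 - y * R / 2) * (V * m y) := by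
            refine mul_le_mul_of_nonneg_left ?_ (div_nonneg (by linarith) (by linarith))
            rw [← bernExp_const_mul]
            exact bernExp_mono hq0 hq1 fun σ => sum_mul_expForm_le w hV y _
        _ ≤ 2 * (y * R / 2) / (1 - θ * R / 2) * (V * m y) := by
            refine mul_le_mul_of_nonneg_right ?_ (mul_nonneg hV0 (hmnn y))
            exact div_le_div_of_nonneg_left (by linarith) (by linarith) (by linarith)
        _ = 2 * c * y * m y := by
            simp only [c]
            field_simp
    have hE := Real.exp_pos (-(c * y ^ 2))
    have := mul_le_mul_of_nonneg_right key hE.le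
    simp only [id, Nat.cast_ofNat] at *
    norm_num
    linarith
  have h := hanti (Set.left_mem_Icc.2 hθ) (Set.right_mem_Icc.2 hθ) hθ
  simp only [hm0] at h
  norm_num at h
  calc m θ = m θ * Real.exp (-(c * θ ^ 2)) * Real.exp (c * θ ^ 2) := by
        rw [mul_assoc, ← Real.exp_add]; simp
    _ ≤ Module.finrank ℝ E * Real.exp (c * θ ^ 2) :=
        mul_le_mul_of_nonneg_right h (Real.exp_pos _).le
    _ = _ := by
        congr 2
        simp only [c]
        ring

/-- Matrix Chernoff bound: upper tail of the largest eigenvalue of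
`∑ (d_k - q_k) w_k w_kᵀ` for independent Bernoulli variables `d_k`. -/
theorem bernProb_rankOneSum_le (hq0 : ∀ k, 0 ≤ q k) (hq1 : ∀ k, q k ≤ 1) (w : κ → E) {R V : ℝ}
    (hV0 : 0 ≤ V) (hR : ∀ k, ‖w k‖ ^ 2 ≤ R) (hR0 : 0 ≤ R)
    (hV : ∀ x : E, ∑ k, q k * inner ℝ (w k) x ^ 2 ≤ V * ‖x‖ ^ 2) {θ : ℝ} (hθ : 0 ≤ θ)
    (hθR : θ * R / 2 < 1) (s : ℝ) :
    bernProb q {σ | ¬ ∀ x : E, ∑ k, centered q σ k * inner ℝ (w k) x ^ 2 ≤ s * ‖x‖ ^ 2} ≤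
      Module.finrank ℝ E * Real.exp (-(θ * s) + V * R * θ ^ 2 / (2 * (1 - θ * R / 2))) := by
  refine (bernProb_le_exp hq0 hq1 (f := fun σ => expTrace w θ (centered q σ))
    (fun σ => expTrace_nonneg _ _ _) (a := θ * s) fun σ hσ => ?_).trans ?_
  · have : ∃ i, s < rankOneEig w (centered q σ) i := by
      by_contra! hcon
      exact hσ (sum_mul_inner_sq_le_of_eig_le w _ hcon)
    obtain ⟨i, hi⟩ := this
    calc Real.exp (θ * s) ≤ Real.exp (θ * rankOneEig w (centered q σ) i) :=
          Real.exp_le_exp.2 (mul_le_mul_of_nonneg_left hi.le hθ)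
      _ ≤ _ := Finset.single_le_sum
          (f := fun i => Real.exp (θ * rankOneEig w (centered q σ) i))
          (fun _ _ => (Real.exp_pos _).le) (Finset.mem_univ i)
  · rw [Real.exp_add, mul_left_comm]
    exact mul_le_mul_of_nonneg_left (bernExp_expTrace_le hq0 hq1 w hV0 hR hR0 hV hθ hθR)
      (Real.exp_pos _).le

end Chernoff

/-! ### Deterministic perturbation of inverse Laplacians -/

section Deterministic

variable {n p : ℕ}

theorem norm_mul_self_le_of_sum_sq_le (A : Matrix (Fin n) (Fin p) ℝ) {c : ℝ} (hc : 0 ≤ c)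
    (h : ∀ x : Fin p → ℝ, ∑ i, (∑ j, A i j * x j) ^ 2 ≤ c * ∑ j, x j ^ 2) :
    ‖A‖ * ‖A‖ ≤ c := by
  have hle : ‖A‖ ≤ √c := by
    rw [Matrix.l2_opNorm_def]
    refine ContinuousLinearMap.opNorm_le_bound _ (Real.sqrt_nonneg _) fun x => ?_
    rw [EuclideanSpace.norm_eq, EuclideanSpace.norm_eq, ← Real.sqrt_mul hc]
    refine Real.sqrt_le_sqrt ?_
    simpa [Matrix.mulVec, dotProduct] using h x
  calc ‖A‖ * ‖A‖ ≤ √c * √c := mul_self_le_mul_self (norm_nonneg _) hle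
    _ = c := Real.mul_self_sqrt hc

/-- Testing with `u = s⁻¹ A x` and `v = x` gives `2 ‖A x‖² ≤ ‖A x‖² + s² ‖x‖²`. A one-sided
hypothesis suffices because `u` is arbitrary. -/
theorem norm_le_of_bilinear_le (A : Matrix (Fin n) (Fin p) ℝ) {s : ℝ} (hs : 0 < s)
    (h : ∀ (u : Fin n → ℝ) (v : Fin p → ℝ),
      2 * ∑ i, ∑ j, u i * A i j * v j ≤ s * (∑ i, u i ^ 2 + ∑ j, v j ^ 2)) : ‖A‖ ≤ s := by
  refine le_of_sq_le_sq ?_ hs.le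
  rw [sq]
  refine norm_mul_self_le_of_sum_sq_le A (sq_nonneg s) fun x => ?_
  have hx := h (fun i => s⁻¹ * ∑ j, A i j * x j) x
  have e : ∑ i, ∑ j, s⁻¹ * (∑ j, A i j * x j) * A i j * x j =
      s⁻¹ * ∑ i, (∑ j, A i j * x j) ^ 2 := by
    rw [Finset.mul_sum]
    refine Finset.sum_congr rfl fun i _ => ?_
    simp only [mul_assoc, ← Finset.mul_sum]
    ring
  rw [e] at hx
  simp only [mul_pow, ← Finset.mul_sum] at hx
  set S := ∑ i, (∑ j, A i j * x j) ^ 2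
  set Q := ∑ j, x j ^ 2
  have h2 := mul_le_mul_of_nonneg_left hx hs.le
  have e2 : s * (2 * (s⁻¹ * S)) = 2 * S := by field_simp
  have e3 : s * (s * (s⁻¹ ^ 2 * S + Q)) = S + s ^ 2 * Q := by field_simp
  linarith

theorem normalizedAdj_apply (a : Fin n → ℝ) (b : Fin p → ℝ) (B : Matrix (Fin n) (Fin p) ℝ)
    (i : Fin n) (j : Fin p) :
    normalizedAdj a b B i j = (√(a i))⁻¹ * B i j * (√(b j))⁻¹ := by
  simp [normalizedAdj, Matrix.mul_diagonal, Matrix.diagonal_mul]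

theorem normalizedAdj_transpose (a : Fin n → ℝ) (b : Fin p → ℝ) (B : Matrix (Fin n) (Fin p) ℝ) :
    (normalizedAdj a b B).transpose = normalizedAdj b a B.transpose := by
  ext i j
  simp only [Matrix.transpose_apply, normalizedAdj_apply]
  ring

theorem norm_transpose (A : Matrix (Fin n) (Fin p) ℝ) : ‖A.transpose‖ = ‖A‖ := by
  rw [← Matrix.conjTranspose_eq_transpose_of_trivial, Matrix.l2_opNorm_conjTranspose]

/-- Schur test: Cauchy–Schwarz along each row with weights `B i j` uses up the row sums, and summing
over rows uses the column sums. -/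
theorem norm_normalizedAdj_mul_self_le {a : Fin n → ℝ} {b : Fin p → ℝ}
    {B : Matrix (Fin n) (Fin p) ℝ} (ha : ∀ i, 0 < a i) (hb : ∀ j, 0 < b j)
    (hB : ∀ i j, 0 ≤ B i j) (hrow : ∀ i, ∑ j, B i j ≤ a i) {r : ℝ} (hr : 0 ≤ r)
    (hcol : ∀ j, ∑ i, B i j ≤ r * b j) :
    ‖normalizedAdj a b B‖ * ‖normalizedAdj a b B‖ ≤ r := by
  refine norm_mul_self_le_of_sum_sq_le _ hr fun x => ?_
  have h1 : ∀ i, (∑ j, normalizedAdj a b B i j * x j) ^ 2 ≤ ∑ j, B i j * (x j ^ 2 / b j) := by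
    intro i
    have e : ∑ j, normalizedAdj a b B i j * x j = (√(a i))⁻¹ * ∑ j, B i j * ((√(b j))⁻¹ * x j) := by
      rw [Finset.mul_sum]
      exact Finset.sum_congr rfl fun j _ => by rw [normalizedAdj_apply]; ring
    have hcs : (∑ j, B i j * ((√(b j))⁻¹ * x j)) ^ 2 ≤
        (∑ j, B i j) * ∑ j, B i j * (x j ^ 2 / b j) := by
      refine Finset.sum_sq_le_sum_mul_sum_of_sq_le_mul _ (fun j _ => hB i j)
        (fun j _ => mul_nonneg (hB i j) (div_nonneg (sq_nonneg _) (hb j).le)) fun j _ => ?_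
      rw [mul_pow, mul_pow, inv_pow, Real.sq_sqrt (hb j).le]
      exact le_of_eq (by ring)
    have hnn : 0 ≤ ∑ j, B i j * (x j ^ 2 / b j) := Finset.sum_nonneg fun j _ =>
      mul_nonneg (hB i j) (div_nonneg (sq_nonneg _) (hb j).le)
    rw [e, mul_pow, inv_pow, Real.sq_sqrt (ha i).le, inv_mul_le_iff₀ (ha i)]
    exact hcs.trans (mul_le_mul_of_nonneg_right (hrow i) hnn)
  calc _ ≤ ∑ i, ∑ j, B i j * (x j ^ 2 / b j) := Finset.sum_le_sum fun i _ => h1 i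
    _ = ∑ j, (∑ i, B i j) * (x j ^ 2 / b j) := by
        rw [Finset.sum_comm]
        exact Finset.sum_congr rfl fun j _ => by rw [Finset.sum_mul]
    _ ≤ ∑ j, r * x j ^ 2 := by
        refine Finset.sum_le_sum fun j _ => ?_
        rw [← mul_div_assoc, div_le_iff₀ (hb j)]
        nlinarith [mul_le_mul_of_nonneg_right (hcol j) (sq_nonneg (x j))]
    _ = _ := by rw [Finset.mul_sum]

/-- The inverse satisfies `Y = 1 + G Y`, whence `‖Y‖ ≤ 1 + (1 - c) ‖Y‖`. -/
theorem isUnit_one_sub_and_norm_inv_le (G : Matrix (Fin p) (Fin p) ℝ) {c : ℝ} (hc : 0 < c)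
    (hG : ‖G‖ ≤ 1 - c) : IsUnit (1 - G) ∧ ‖(1 - G)⁻¹‖ ≤ c⁻¹ := by
  have hu : IsUnit (1 - G) := isUnit_one_sub_of_norm_lt_one (by linarith)
  refine ⟨hu, ?_⟩
  have h1 : ‖(1 : Matrix (Fin p) (Fin p) ℝ)‖ ≤ 1 := by
    rw [← Matrix.diagonal_one, Matrix.l2_opNorm_diagonal]
    exact (pi_norm_le_iff_of_nonneg zero_le_one).2 fun i => by simp
  have hm : (1 - G) * (1 - G)⁻¹ = 1 :=
    Matrix.mul_nonsing_inv _ ((Matrix.isUnit_iff_isUnit_det _).1 hu)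
  set Y := (1 - G)⁻¹
  have hY : Y = 1 + G * Y := by
    rw [← hm]; noncomm_ring
  have h2 : ‖Y‖ ≤ 1 + (1 - c) * ‖Y‖ := by
    calc ‖Y‖ = ‖1 + G * Y‖ := by rw [← hY]
      _ ≤ ‖(1 : Matrix (Fin p) (Fin p) ℝ)‖ + ‖G * Y‖ := norm_add_le _ _
      _ ≤ 1 + ‖G‖ * ‖Y‖ := add_le_add h1 (norm_mul_le _ _)
      _ ≤ _ := by gcongr
  rw [← one_div, le_div_iff₀ hc]
  linarith

/-- The ridge `l` is at least the fraction `l / D` of every `b j`, so columns sum to at most `(1 - l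
/ D) * b j` and the Schur test leaves a spectral gap `l / D`. -/
theorem firmLaplacian_isUnit_and_norm_inv_le {a : Fin n → ℝ} {b : Fin p → ℝ}
    {B : Matrix (Fin n) (Fin p) ℝ} (ha : ∀ i, 0 < a i) (hb : ∀ j, 0 < b j)
    (hB : ∀ i j, 0 ≤ B i j) (hrow : ∀ i, ∑ j, B i j ≤ a i) {l D : ℝ} (hl : 0 < l) (hlD : l ≤ D)
    (hcol : ∀ j, ∑ i, B i j + l ≤ b j) (hD : ∀ j, b j ≤ D) :
    ‖normalizedAdj a b B‖ ≤ 1 ∧ IsUnit (firmLaplacian (normalizedAdj a b B)) ∧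
      ‖(firmLaplacian (normalizedAdj a b B))⁻¹‖ ≤ D / l := by
  have hD0 : 0 < D := hl.trans_le hlD
  have hc : 0 < l / D := div_pos hl hD0
  have hnorm : ‖normalizedAdj a b B‖ * ‖normalizedAdj a b B‖ ≤ 1 - l / D := by
    refine norm_normalizedAdj_mul_self_le ha hb hB hrow ?_ fun j => ?_
    · rw [sub_nonneg, div_le_one hD0]
      exact hlD
    · have : l / D * b j ≤ l := by
        rw [div_mul_eq_mul_div, div_le_iff₀ hD0]
        exact mul_le_mul_of_nonneg_left (hD j) hl.le
      linarith [hcol j]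
  have hG : ‖(normalizedAdj a b B).transpose * normalizedAdj a b B‖ ≤ 1 - l / D := by
    rwa [← Matrix.conjTranspose_eq_transpose_of_trivial, Matrix.l2_opNorm_conjTranspose_mul_self]
  have h := isUnit_one_sub_and_norm_inv_le _ hc hG
  rw [inv_div] at h
  exact ⟨by nlinarith [norm_nonneg (normalizedAdj a b B)], h⟩

theorem norm_firmLaplacian_sub_le {E F : Matrix (Fin n) (Fin p) ℝ} (hE : ‖E‖ ≤ 1) (hF : ‖F‖ ≤ 1) :
    ‖firmLaplacian F - firmLaplacian E‖ ≤ 2 * ‖E - F‖ := by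
  have e : firmLaplacian F - firmLaplacian E =
      E.transpose * (E - F) + (E - F).transpose * F := by
    simp only [firmLaplacian, Matrix.transpose_sub, Matrix.mul_sub, Matrix.sub_mul]
    abel
  rw [e]
  calc _ ≤ ‖E.transpose * (E - F)‖ + ‖(E - F).transpose * F‖ := norm_add_le _ _
    _ ≤ ‖E.transpose‖ * ‖E - F‖ + ‖(E - F).transpose‖ * ‖F‖ :=
        add_le_add (Matrix.l2_opNorm_mul _ _) (Matrix.l2_opNorm_mul _ _)
    _ ≤ 1 * ‖E - F‖ + ‖E - F‖ * 1 := by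
        rw [norm_transpose, norm_transpose]
        gcongr
    _ = _ := by ring

/-- With `s = √(x / y) ≥ 0`, one has `|1 - s| ≤ |1 - s| (1 + s) = |1 - x / y|`. -/
theorem abs_one_sub_sqrt_div_le {x y t : ℝ} (hy : 0 < y) (hx : 0 ≤ x) (h : |x - y| ≤ t * y) :
    |1 - √(x / y)| ≤ t := by
  have hs := Real.sqrt_nonneg (x / y)
  have hsq := Real.sq_sqrt (div_nonneg hx hy.le)
  have hxy : |1 - x / y| ≤ t := by
    have e : 1 - x / y = -((x - y) / y) := by field_simp; ring
    rw [e, abs_neg, abs_div, abs_of_pos hy, div_le_iff₀ hy]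
    exact h
  refine le_trans ?_ hxy
  set s := √(x / y)
  rw [← hsq]
  have : 1 - s ^ 2 = (1 - s) * (1 + s) := by ring
  rw [this, abs_mul]
  refine le_mul_of_one_le_right (abs_nonneg _) ?_
  rw [abs_of_nonneg (by linarith)]
  linarith

theorem norm_diagonal_le {m : ℕ} {r : Fin m → ℝ} {t : ℝ} (ht : 0 ≤ t) (h : ∀ i, |r i| ≤ t) :
    ‖Matrix.diagonal r‖ ≤ t := by
  rw [Matrix.l2_opNorm_diagonal]
  exact (pi_norm_le_iff_of_nonneg ht).2 h

/-- Replacing the degrees in the normalization by nearby ones. -/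
theorem norm_normalizedAdj_sub_le {a α : Fin n → ℝ} {b β : Fin p → ℝ}
    {B : Matrix (Fin n) (Fin p) ℝ} (ha : ∀ i, 0 < a i) (hb : ∀ j, 0 < b j)
    (hα : ∀ i, 0 < α i) (hβ : ∀ j, 0 < β j) {t : ℝ} (ht : 0 ≤ t)
    (haα : ∀ i, |a i - α i| ≤ t * α i) (hbβ : ∀ j, |b j - β j| ≤ t * β j)
    (hE : ‖normalizedAdj a b B‖ ≤ 1) :
    ‖normalizedAdj a b B - normalizedAdj α β B‖ ≤ 2 * t + t ^ 2 := by
  set E := normalizedAdj a b B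
  let r : Fin n → ℝ := fun i => 1 - √(a i / α i)
  let c : Fin p → ℝ := fun j => 1 - √(b j / β j)
  have hr : ‖Matrix.diagonal r‖ ≤ t :=
    norm_diagonal_le ht fun i => abs_one_sub_sqrt_div_le (hα i) (ha i).le (haα i)
  have hc : ‖Matrix.diagonal c‖ ≤ t :=
    norm_diagonal_le ht fun j => abs_one_sub_sqrt_div_le (hβ j) (hb j).le (hbβ j)
  -- Renormalizing multiplies `E` by `1 - r` on the left and `1 - c` on the right, and both diagonal
  -- corrections have norm at most `t`.
  have e : E - normalizedAdj α β B =
      Matrix.diagonal r * E + E * Matrix.diagonal c - Matrix.diagonal r * E * Matrix.diagonal c := by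
    ext i j
    have h1 : (√(α i))⁻¹ = (1 - r i) * (√(a i))⁻¹ := by
      simp only [r, sub_sub_cancel, Real.sqrt_div (ha i).le]
      have := (Real.sqrt_pos.2 (ha i)).ne'
      field_simp
    have h2 : (√(β j))⁻¹ = (1 - c j) * (√(b j))⁻¹ := by
      simp only [c, sub_sub_cancel, Real.sqrt_div (hb j).le]
      have := (Real.sqrt_pos.2 (hb j)).ne'
      field_simp
    simp only [Matrix.sub_apply, Matrix.add_apply, Matrix.diagonal_mul, Matrix.mul_diagonal, E,
      normalizedAdj_apply, h1, h2]
    ring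
  rw [e]
  have hrE : ‖Matrix.diagonal r * E‖ ≤ t :=
    (Matrix.l2_opNorm_mul _ _).trans (by nlinarith [norm_nonneg E])
  have hEc : ‖E * Matrix.diagonal c‖ ≤ t :=
    (Matrix.l2_opNorm_mul _ _).trans (by nlinarith [norm_nonneg (Matrix.diagonal c)])
  have hrEc : ‖Matrix.diagonal r * E * Matrix.diagonal c‖ ≤ t * t :=
    (Matrix.l2_opNorm_mul _ _).trans
      (mul_le_mul hrE hc (norm_nonneg _) ht)
  calc _ ≤ ‖Matrix.diagonal r * E + E * Matrix.diagonal c‖ +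
        ‖Matrix.diagonal r * E * Matrix.diagonal c‖ := norm_sub_le _ _
    _ ≤ (t + t) + t * t := add_le_add ((norm_add_le _ _).trans (add_le_add hrE hEc)) hrEc
    _ = _ := by ring

theorem normalizedAdj_sub (a : Fin n → ℝ) (b : Fin p → ℝ) (B C : Matrix (Fin n) (Fin p) ℝ) :
    normalizedAdj a b (B - C) = normalizedAdj a b B - normalizedAdj a b C := by
  simp [normalizedAdj, Matrix.mul_sub, Matrix.sub_mul]

theorem norm_inv_sub_inv_le {X Y : Matrix (Fin p) (Fin p) ℝ} (hX : IsUnit X) (hY : IsUnit Y) :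
    ‖X⁻¹ - Y⁻¹‖ ≤ ‖X⁻¹‖ * ‖Y - X‖ * ‖Y⁻¹‖ := by
  have e : X⁻¹ - Y⁻¹ = X⁻¹ * (Y - X) * Y⁻¹ := by
    rw [Matrix.mul_sub, Matrix.sub_mul,
      Matrix.nonsing_inv_mul _ ((Matrix.isUnit_iff_isUnit_det _).1 hX), Matrix.mul_assoc,
      Matrix.mul_nonsing_inv _ ((Matrix.isUnit_iff_isUnit_det _).1 hY), Matrix.mul_one,
      Matrix.one_mul]
  rw [e]
  exact (norm_mul_le _ _).trans (mul_le_mul_of_nonneg_right (norm_mul_le _ _) (norm_nonneg _))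

/-- Deterministic perturbation bound for inverse regularized Laplacians. -/
theorem norm_firmLaplacian_inv_sub_le {a α : Fin n → ℝ} {b β : Fin p → ℝ}
    {B C : Matrix (Fin n) (Fin p) ℝ} (hα : ∀ i, 0 < α i) (hβ : ∀ j, 0 < β j)
    (ha : ∀ i, 0 < a i) (hb : ∀ j, 0 < b j)
    (hB : ∀ i j, 0 ≤ B i j) (hC : ∀ i j, 0 ≤ C i j)
    (hBrow : ∀ i, ∑ j, B i j ≤ a i) (hCrow : ∀ i, ∑ j, C i j ≤ α i) {l D t : ℝ}
    (hl : 0 < l) (hlD : l ≤ D) (hBcol : ∀ j, ∑ i, B i j + l ≤ b j)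
    (hCcol : ∀ j, ∑ i, C i j + l ≤ β j) (hD : ∀ j, β j ≤ D) (ht : 0 ≤ t) (ht1 : t ≤ 1)
    (haα : ∀ i, |a i - α i| ≤ t * α i) (hbβ : ∀ j, |b j - β j| ≤ t * β j)
    (hX : t < 3 / 16 → ‖normalizedAdj α β (B - C)‖ ≤ 3 * t) :
    IsUnit (firmLaplacian (normalizedAdj a b B)) ∧
      ‖(firmLaplacian (normalizedAdj a b B))⁻¹ - (firmLaplacian (normalizedAdj α β C))⁻¹‖ ≤
        16 * t * (D / l) ^ 2 := by
  have hD0 : 0 < D := hl.trans_le hlD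
  obtain ⟨hF1, hFu, hFi⟩ := firmLaplacian_isUnit_and_norm_inv_le hα hβ hC hCrow hl hlD hCcol hD
  obtain ⟨hE1, hEu, hEi⟩ := firmLaplacian_isUnit_and_norm_inv_le (D := (1 + t) * D) ha hb hB hBrow
    hl (by nlinarith) hBcol fun j => by
      have h1 := (abs_le.1 (hbβ j)).2
      nlinarith [hD j]
  refine ⟨hEu, ?_⟩
  have hq : 1 ≤ D / l := (one_le_div hl).2 hlD
  rw [mul_div_assoc] at hEi
  set q := D / l
  set E := normalizedAdj a b B
  set F := normalizedAdj α β C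
  -- For `t ≥ 3/16` the claimed bound exceeds `3 q²` and the triangle inequality suffices; hence
  -- concentration is needed only for `t < 3/16`. There `2t + t² + 3t ≤ 6t` and `12 (1 + t) ≤ 16`.
  rcases le_or_gt (3 / 16) t with h | h
  · calc _ ≤ ‖(firmLaplacian E)⁻¹‖ + ‖(firmLaplacian F)⁻¹‖ := norm_sub_le _ _
      _ ≤ (1 + t) * q + q := add_le_add hEi hFi
      _ ≤ 3 * q := by nlinarith
      _ ≤ 3 * q ^ 2 := by nlinarith
      _ ≤ 16 * t * q ^ 2 := by gcongr; linarith
  · have h1 : ‖E - F‖ ≤ 6 * t := by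
      have e : E - F = (E - normalizedAdj α β B) + normalizedAdj α β (B - C) := by
        rw [normalizedAdj_sub]; simp only [F]; abel
      rw [e]
      have := norm_normalizedAdj_sub_le ha hb hα hβ ht haα hbβ hE1
      have := hX h
      refine (norm_add_le _ _).trans ?_
      nlinarith
    have h2 : ‖firmLaplacian F - firmLaplacian E‖ ≤ 12 * t := by
      linarith [norm_firmLaplacian_sub_le hE1 hF1]
    calc _ ≤ ‖(firmLaplacian E)⁻¹‖ * ‖firmLaplacian F - firmLaplacian E‖ *
          ‖(firmLaplacian F)⁻¹‖ := norm_inv_sub_inv_le hEu hFu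
      _ ≤ ((1 + t) * q) * (12 * t) * q := by gcongr
      _ = 12 * (1 + t) * (t * q ^ 2) := by ring
      _ ≤ 16 * (t * q ^ 2) := by gcongr; linarith
      _ = _ := by ring

theorem workerLaplacian_normalizedAdj (a : Fin n → ℝ) (b : Fin p → ℝ)
    (B : Matrix (Fin n) (Fin p) ℝ) :
    workerLaplacian (normalizedAdj a b B) = firmLaplacian (normalizedAdj b a B.transpose) := by
  rw [workerLaplacian, firmLaplacian, ← normalizedAdj_transpose, Matrix.transpose_transpose]

end Deterministic

/-! ### Concentration of the normalized adjacency matrix -/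

section Concentration

theorem bernProb_abs_weighted_sum_ge {κ : Type*} [Fintype κ] [DecidableEq κ] {q : κ → ℝ}
    (hq0 : ∀ k, 0 ≤ q k) (hq1 : ∀ k, q k ≤ 1) (c : κ → ℝ) (hc : ∀ k, |c k| ≤ 1) {t Δ : ℝ}
    (ht : 0 ≤ t) (ht1 : t ≤ 1) (hΔ : ∑ k, q k * c k ^ 2 ≤ Δ) :
    bernProb q {σ | t * Δ ≤ |∑ k, c k * centered q σ k|} ≤ 2 * Real.exp (-(t ^ 2 * Δ / 3)) := by
  have one : ∀ c' : κ → ℝ, (∀ k, |c' k| ≤ 1) → ∑ k, q k * c' k ^ 2 ≤ Δ →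
      bernProb q {σ | t * Δ ≤ ∑ k, c' k * centered q σ k} ≤ Real.exp (-(t ^ 2 * Δ / 3)) := by
    intro c' hc' hΔ'
    -- The value `2t/3` minimizes `-θ t Δ + (3/4) θ² Δ`, with minimum `-t² Δ / 3`, and `t ≤ 1` keeps
    -- it within the range of the exponential estimate.
    refine (bernProb_weighted_sum_ge hq0 hq1 c' (2 * t / 3) (by positivity) (fun k => ?_)
      (t * Δ)).trans (Real.exp_le_exp.2 ?_)
    · rw [abs_mul, abs_of_nonneg (by positivity)]
      nlinarith [hc' k, abs_nonneg (c' k)]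
    · nlinarith [mul_le_mul_of_nonneg_left hΔ' (sq_nonneg t)]
  have hsub : {σ | t * Δ ≤ |∑ k, c k * centered q σ k|} ⊆
      {σ | t * Δ ≤ ∑ k, c k * centered q σ k} ∪ {σ | t * Δ ≤ ∑ k, -c k * centered q σ k} := by
    intro σ hσ
    simpa only [Set.mem_union, Set.mem_ofPred_eq, neg_mul, Finset.sum_neg_distrib] using
      le_abs.1 hσ
  have h1 := one c hc hΔ
  have h2 := one (fun k => -c k) (by simpa using hc) (by simpa using hΔ)
  have h3 := bernProb_mono hq0 hq1 hsub
  have h4 := bernProb_union_le hq0 hq1 {σ | t * Δ ≤ ∑ k, c k * centered q σ k}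
    {σ | t * Δ ≤ ∑ k, -c k * centered q σ k}
  linarith

/-! ### The signless Laplacian of the random bipartite network. -/

variable {n p : ℕ}

/-- The vector `e_i / √α_i + e_j / √β_j` of a worker-firm pair. -/
def pairVec (α : Fin n → ℝ) (β : Fin p → ℝ) (k : Fin n × Fin p) :
    EuclideanSpace ℝ (Fin n ⊕ Fin p) :=
  EuclideanSpace.single (Sum.inl k.1) (√(α k.1))⁻¹ +
    EuclideanSpace.single (Sum.inr k.2) (√(β k.2))⁻¹

theorem inner_pairVec (α : Fin n → ℝ) (β : Fin p → ℝ) (k : Fin n × Fin p)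
    (x : EuclideanSpace ℝ (Fin n ⊕ Fin p)) :
    inner ℝ (pairVec α β k) x =
      (√(α k.1))⁻¹ * x (Sum.inl k.1) + (√(β k.2))⁻¹ * x (Sum.inr k.2) := by
  simp [pairVec, inner_add_left, EuclideanSpace.inner_single_left]

theorem norm_pairVec_sq {α : Fin n → ℝ} {β : Fin p → ℝ} (hα : ∀ i, 0 < α i) (hβ : ∀ j, 0 < β j)
    (k : Fin n × Fin p) : ‖pairVec α β k‖ ^ 2 = (α k.1)⁻¹ + (β k.2)⁻¹ := by
  rw [← real_inner_self_eq_norm_sq, inner_pairVec]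
  simp only [pairVec, PiLp.add_apply, PiLp.single_apply, reduceCtorEq, if_true, if_false,
    add_zero, zero_add]
  rw [← mul_inv, ← mul_inv, Real.mul_self_sqrt (hα _).le, Real.mul_self_sqrt (hβ _).le]

theorem norm_sq_sum (x : EuclideanSpace ℝ (Fin n ⊕ Fin p)) :
    ‖x‖ ^ 2 = ∑ i, x (Sum.inl i) ^ 2 + ∑ j, x (Sum.inr j) ^ 2 := by
  rw [EuclideanSpace.real_norm_sq_eq, Fintype.sum_sum_type]

/-- The signless normalized Laplacian of the expected network is at most `2`. -/
theorem sum_mul_inner_pairVec_sq_le {α : Fin n → ℝ} {β : Fin p → ℝ} (hα : ∀ i, 0 < α i)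
    (hβ : ∀ j, 0 < β j) {q : Fin n × Fin p → ℝ} (hq0 : ∀ k, 0 ≤ q k)
    (hrow : ∀ i, ∑ j, q (i, j) ≤ α i) (hcol : ∀ j, ∑ i, q (i, j) ≤ β j)
    (x : EuclideanSpace ℝ (Fin n ⊕ Fin p)) :
    ∑ k, q k * inner ℝ (pairVec α β k) x ^ 2 ≤ 2 * ‖x‖ ^ 2 := by
  rw [norm_sq_sum, Fintype.sum_prod_type]
  have h : ∀ i j, q (i, j) * inner ℝ (pairVec α β (i, j)) x ^ 2 ≤
      q (i, j) * (2 * (x (Sum.inl i) ^ 2 / α i)) + q (i, j) * (2 * (x (Sum.inr j) ^ 2 / β j)) := by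
    intro i j
    rw [inner_pairVec, ← mul_add]
    refine mul_le_mul_of_nonneg_left ?_ (hq0 _)
    have e1 : x (Sum.inl i) ^ 2 / α i = ((√(α i))⁻¹ * x (Sum.inl i)) ^ 2 := by
      rw [mul_pow, inv_pow, Real.sq_sqrt (hα i).le]; ring
    have e2 : x (Sum.inr j) ^ 2 / β j = ((√(β j))⁻¹ * x (Sum.inr j)) ^ 2 := by
      rw [mul_pow, inv_pow, Real.sq_sqrt (hβ j).le]; ring
    rw [e1, e2]
    linarith [sq_nonneg ((√(α i))⁻¹ * x (Sum.inl i) - (√(β j))⁻¹ * x (Sum.inr j))]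
  calc _ ≤ ∑ i, ∑ j, (q (i, j) * (2 * (x (Sum.inl i) ^ 2 / α i)) +
          q (i, j) * (2 * (x (Sum.inr j) ^ 2 / β j))) :=
        Finset.sum_le_sum fun i _ => Finset.sum_le_sum fun j _ => h i j
    _ = ∑ i, (∑ j, q (i, j)) * (2 * (x (Sum.inl i) ^ 2 / α i)) +
          ∑ j, (∑ i, q (i, j)) * (2 * (x (Sum.inr j) ^ 2 / β j)) := by
        simp only [Finset.sum_add_distrib, Finset.sum_mul]
        congr 1
        exact Finset.sum_comm
    _ ≤ ∑ i, 2 * x (Sum.inl i) ^ 2 + ∑ j, 2 * x (Sum.inr j) ^ 2 := by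
        refine add_le_add (Finset.sum_le_sum fun i _ => ?_) (Finset.sum_le_sum fun j _ => ?_)
        · refine (mul_le_mul_of_nonneg_right (hrow i)
            (mul_nonneg zero_le_two (div_nonneg (sq_nonneg _) (hα i).le))).trans_eq ?_
          have := (hα i).ne'
          field_simp
        · refine (mul_le_mul_of_nonneg_right (hcol j)
            (mul_nonneg zero_le_two (div_nonneg (sq_nonneg _) (hβ j).le))).trans_eq ?_
          have := (hβ j).ne'
          field_simp
    _ = _ := by rw [← Finset.mul_sum, ← Finset.mul_sum, mul_add]

/-- A one-sided bound for the signless Laplacian and bounds for the degrees control the spectral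
norm of the normalized adjacency matrix. -/
theorem norm_normalizedAdj_le_of_signless {α : Fin n → ℝ} {β : Fin p → ℝ} (hα : ∀ i, 0 < α i)
    (hβ : ∀ j, 0 < β j) (ξ : Fin n × Fin p → ℝ) {t : ℝ} (ht : 0 < t)
    (hrow : ∀ i, |∑ j, ξ (i, j)| ≤ t * α i) (hcol : ∀ j, |∑ i, ξ (i, j)| ≤ t * β j)
    (h : ∀ x, ∑ k, ξ k * inner ℝ (pairVec α β k) x ^ 2 ≤ 2 * t * ‖x‖ ^ 2) :
    ‖normalizedAdj α β (Matrix.of fun i j => ξ (i, j))‖ ≤ 3 * t := by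
  refine norm_le_of_bilinear_le _ (by positivity) fun u v => ?_
  have hx := h (WithLp.toLp 2 (Sum.elim u v))
  rw [norm_sq_sum, Fintype.sum_prod_type] at hx
  simp only [inner_pairVec, Sum.elim_inl, Sum.elim_inr] at hx
  -- Expanding the square: the diagonal terms carry row and column sums of `ξ`, hence are at least
  -- `-t (‖u‖² + ‖v‖²)`. Moving them across turns `2t` into `3t`.
  have e : ∑ i, ∑ j, ξ (i, j) * ((√(α i))⁻¹ * u i + (√(β j))⁻¹ * v j) ^ 2 =
      ∑ i, (∑ j, ξ (i, j)) * (u i ^ 2 / α i) + ∑ j, (∑ i, ξ (i, j)) * (v j ^ 2 / β j) +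
      2 * ∑ i, ∑ j, u i * normalizedAdj α β (Matrix.of fun i j => ξ (i, j)) i j * v j := by
    have e1 : ∑ j, (∑ i, ξ (i, j)) * (v j ^ 2 / β j) =
        ∑ i, ∑ j, ξ (i, j) * (v j ^ 2 / β j) := by
      simp only [Finset.sum_mul]
      exact Finset.sum_comm
    rw [e1]
    simp only [Finset.sum_mul, Finset.mul_sum, ← Finset.sum_add_distrib]
    refine Finset.sum_congr rfl fun i _ => Finset.sum_congr rfl fun j _ => ?_
    have h1 : u i ^ 2 / α i = ((√(α i))⁻¹ * u i) ^ 2 := by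
      rw [mul_pow, inv_pow, Real.sq_sqrt (hα i).le]; ring
    have h2 : v j ^ 2 / β j = ((√(β j))⁻¹ * v j) ^ 2 := by
      rw [mul_pow, inv_pow, Real.sq_sqrt (hβ j).le]; ring
    rw [h1, h2, normalizedAdj_apply, Matrix.of_apply]
    ring
  rw [e] at hx
  have hu : ∑ i, -(t * u i ^ 2) ≤ ∑ i, (∑ j, ξ (i, j)) * (u i ^ 2 / α i) := by
    refine Finset.sum_le_sum fun i _ => ?_
    have h1 := mul_le_mul_of_nonneg_right (abs_le.1 (hrow i)).1
      (div_nonneg (sq_nonneg (u i)) (hα i).le)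
    refine le_trans (le_of_eq ?_) h1
    have := (hα i).ne'
    field_simp
  have hv : ∑ j, -(t * v j ^ 2) ≤ ∑ j, (∑ i, ξ (i, j)) * (v j ^ 2 / β j) := by
    refine Finset.sum_le_sum fun j _ => ?_
    have h1 := mul_le_mul_of_nonneg_right (abs_le.1 (hcol j)).1
      (div_nonneg (sq_nonneg (v j)) (hβ j).le)
    refine le_trans (le_of_eq ?_) h1
    have := (hβ j).ne'
    field_simp
  rw [Finset.sum_neg_distrib, ← Finset.mul_sum] at hu hv
  linarith

/-- Configurations whose degrees and normalized adjacency matrix are close to their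
expectations. -/
def goodSet (q : Fin n × Fin p → ℝ) (α : Fin n → ℝ) (β : Fin p → ℝ) (t : ℝ) :
    Set (Fin n × Fin p → Bool) :=
  {σ | (∀ i, |∑ j, centered q σ (i, j)| < t * α i) ∧ (∀ j, |∑ i, centered q σ (i, j)| < t * β j) ∧
    (t < 3 / 16 → ‖normalizedAdj α β (Matrix.of fun i j => centered q σ (i, j))‖ ≤ 3 * t)}

theorem bernProb_compl_goodSet_le {q : Fin n × Fin p → ℝ} (hq0 : ∀ k, 0 ≤ q k)
    (hq1 : ∀ k, q k ≤ 1) {α : Fin n → ℝ} {β : Fin p → ℝ} (hα : ∀ i, 0 < α i) (hβ : ∀ j, 0 < β j)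
    (hrow : ∀ i, ∑ j, q (i, j) ≤ α i) (hcol : ∀ j, ∑ i, q (i, j) ≤ β j) {M : ℝ} (hM : 0 < M)
    (hαM : ∀ i, (α i)⁻¹ ≤ M) (hβM : ∀ j, (β j)⁻¹ ≤ M) {t : ℝ} (ht : 0 < t) (ht1 : t ≤ 1) :
    bernProb q (goodSet q α β t)ᶜ ≤ 3 * (((n : ℝ) + p) * Real.exp (-(t ^ 2 / (3 * M)))) := by
  set δ := Real.exp (-(t ^ 2 / (3 * M)))
  let S1 : Fin n → Set (Fin n × Fin p → Bool) := fun i => {σ | t * α i ≤ |∑ j, centered q σ (i, j)|}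
  let S2 : Fin p → Set (Fin n × Fin p → Bool) := fun j => {σ | t * β j ≤ |∑ i, centered q σ (i, j)|}
  let S3 : Set (Fin n × Fin p → Bool) := {σ | ¬ ∀ x : EuclideanSpace ℝ (Fin n ⊕ Fin p),
    ∑ k, centered q σ k * inner ℝ (pairVec α β k) x ^ 2 ≤ 2 * t * ‖x‖ ^ 2}
  let S3' : Set (Fin n × Fin p → Bool) := {σ | t < 3 / 16 ∧ σ ∈ S3}
  have hδ : ∀ Δ : ℝ, 0 < Δ → Δ⁻¹ ≤ M → Real.exp (-(t ^ 2 * Δ / 3)) ≤ δ := by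
    intro Δ hΔ hΔM
    refine Real.exp_le_exp.2 (neg_le_neg ?_)
    have h1 : 1 ≤ M * Δ := by
      rw [← div_le_iff₀ hΔ, one_div]; exact hΔM
    rw [div_le_div_iff₀ (by positivity) (by norm_num)]
    nlinarith [mul_le_mul_of_nonneg_left h1 (sq_nonneg t)]
  have h1 : ∀ i, bernProb q (S1 i) ≤ 2 * δ := by
    intro i
    have h := bernProb_abs_weighted_sum_ge hq0 hq1 (fun k => if k.1 = i then 1 else 0)
      (fun k => by split_ifs <;> simp) ht.le ht1 (Δ := α i) (by
        refine le_of_eq_of_le ?_ (hrow i)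
        rw [Fintype.sum_prod_type, Finset.sum_eq_single i] <;> simp +contextual)
    have e : ∀ σ, ∑ k : Fin n × Fin p, (if k.1 = i then (1 : ℝ) else 0) * centered q σ k =
        ∑ j, centered q σ (i, j) := by
      intro σ
      rw [Fintype.sum_prod_type, Finset.sum_eq_single i] <;> simp +contextual
    simp only [e] at h
    exact h.trans (by linarith [hδ (α i) (hα i) (hαM i)])
  have h2 : ∀ j, bernProb q (S2 j) ≤ 2 * δ := by
    intro j
    have h := bernProb_abs_weighted_sum_ge hq0 hq1 (fun k => if k.2 = j then 1 else 0)
      (fun k => by split_ifs <;> simp) ht.le ht1 (Δ := β j) (by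
        refine le_of_eq_of_le ?_ (hcol j)
        rw [Fintype.sum_prod_type_right, Finset.sum_eq_single j] <;> simp +contextual)
    have e : ∀ σ, ∑ k : Fin n × Fin p, (if k.2 = j then (1 : ℝ) else 0) * centered q σ k =
        ∑ i, centered q σ (i, j) := by
      intro σ
      rw [Fintype.sum_prod_type_right, Finset.sum_eq_single j] <;> simp +contextual
    simp only [e] at h
    exact h.trans (by linarith [hδ (β j) (hβ j) (hβM j)])
  have h3 : bernProb q S3' ≤ ((n : ℝ) + p) * δ := by
    rcases lt_or_ge t (3 / 16) with hlt | hge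
    · have hsub : S3' ⊆ S3 := fun σ hσ => hσ.2
      refine (bernProb_mono hq0 hq1 hsub).trans ?_
      -- Here `R = 2M`, `V = 2` and `s = 2t`. With `θ = t / (2M)` the exponent is `-(t² / M) (1 - 1
      -- / (2 - t))`, and `1 / (2 - t) ≤ 2/3` for `t < 3/16`, leaving `-t² / (3M)`.
      have hθR : t / (2 * M) * (2 * M) / 2 = t / 2 := by field_simp
      have h := bernProb_rankOneSum_le hq0 hq1 (pairVec α β) (R := 2 * M) zero_le_two
        (fun k => by
          rw [norm_pairVec_sq hα hβ]
          linarith [hαM k.1, hβM k.2]) (by positivity)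
        (sum_mul_inner_pairVec_sq_le hα hβ hq0 hrow hcol) (θ := t / (2 * M)) (by positivity)
        (by rw [hθR]; linarith) (2 * t)
      refine h.trans ?_
      rw [hθR, finrank_euclideanSpace, Fintype.card_sum, Fintype.card_fin, Fintype.card_fin,
        Nat.cast_add]
      refine mul_le_mul_of_nonneg_left (Real.exp_le_exp.2 ?_) (by positivity)
      have hden : 0 < 2 * (1 - t / 2) := by linarith
      have e1 : 2 * (2 * M) * (t / (2 * M)) ^ 2 / (2 * (1 - t / 2)) =
          t ^ 2 / M * (1 / (2 * (1 - t / 2))) := by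
        field_simp
      have e2 : t / (2 * M) * (2 * t) = t ^ 2 / M := by field_simp
      have e3 : t ^ 2 / (3 * M) = t ^ 2 / M * (1 / 3) := by field_simp
      have h4 : 1 / (2 * (1 - t / 2)) ≤ 2 / 3 := by
        rw [div_le_div_iff₀ hden (by norm_num)]
        linarith
      rw [e1, e2, e3]
      have h5 : 0 ≤ t ^ 2 / M := by positivity
      nlinarith [mul_le_mul_of_nonneg_left h4 h5]
    · have : S3' = ∅ := by
        ext σ
        simp only [S3', Set.mem_ofPred_eq, Set.mem_empty_iff_false, iff_false, not_and]
        intro h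
        linarith
      rw [this]
      have : bernProb q (∅ : Set (Fin n × Fin p → Bool)) = 0 := by simp [bernProb]
      rw [this]
      positivity
  have hsub : (goodSet q α β t)ᶜ ⊆ ((⋃ i, S1 i) ∪ ⋃ j, S2 j) ∪ S3' := by
    intro σ hσ
    by_contra hcon
    simp only [Set.mem_union, Set.mem_iUnion, not_or, not_exists, S1, S2, Set.mem_ofPred_eq,
      not_le] at hcon
    obtain ⟨⟨c1, c2⟩, c3⟩ := hcon
    refine hσ ⟨c1, c2, fun hlt => ?_⟩
    have c4 : σ ∉ S3 := fun h => c3 ⟨hlt, h⟩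
    simp only [S3, Set.mem_ofPred_eq, not_not] at c4
    exact norm_normalizedAdj_le_of_signless hα hβ (centered q σ) ht (fun i => (c1 i).le)
      (fun j => (c2 j).le) c4
  have b1 : bernProb q (⋃ i, S1 i) ≤ n * (2 * δ) := by
    refine (bernProb_iUnion_le hq0 hq1 S1).trans ((Finset.sum_le_sum fun i _ => h1 i).trans_eq ?_)
    simp
  have b2 : bernProb q (⋃ j, S2 j) ≤ p * (2 * δ) := by
    refine (bernProb_iUnion_le hq0 hq1 S2).trans ((Finset.sum_le_sum fun j _ => h2 j).trans_eq ?_)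
    simp
  have b3 := bernProb_mono hq0 hq1 hsub
  have b4 := bernProb_union_le hq0 hq1 ((⋃ i, S1 i) ∪ ⋃ j, S2 j) S3'
  have b5 := bernProb_union_le hq0 hq1 (⋃ i, S1 i) (⋃ j, S2 j)
  linarith

end Concentration

/-! ### The law of the network and its expected degrees -/

section Network

variable {n p K : ℕ}

/-- The network encoded by a configuration of edges. -/
def netOf (σ : Fin n × Fin p → Bool) (i : Fin n) (j : Fin p) : ℕ := if σ (i, j) then 1 else 0

namespace BlockModel

/-- Edge probabilities indexed by pairs. -/
def edgeProb (S : BlockModel n p K) (k : Fin n × Fin p) : ℝ := S.prob k.1 k.2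

/-- The law of the network is the product of Bernoulli laws. -/
theorem bernProb_le_measureReal (S : BlockModel n p K) {Ω : Type*} [MeasurableSpace Ω]
    (μ : Measure Ω) [IsProbabilityMeasure μ] {d : Fin n → Fin p → Ω → ℕ} (hd : S.IsNetwork μ d)
    (P : (Fin n → Fin p → ℕ) → Prop) :
    bernProb S.edgeProb {σ | P (netOf σ)} ≤ μ.real {ω | P fun i j => d i j ω} := by
  classical
  have hae : ∀ k : Fin n × Fin p, AEMeasurable (d k.1 k.2) μ := fun k => (hd.law k.1 k.2).aemeasurable
  have hmap := (iIndepFun_iff_map_fun_eq_pi_map hae).1 hd.indep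
  have hlaw : ∀ k : Fin n × Fin p, μ.map (d k.1 k.2) =
      bernoulliMeasure 1 0 ⟨S.prob k.1 k.2, S.prob_mem k.1 k.2⟩ := fun k => (hd.law k.1 k.2).map_eq
  simp only [hlaw] at hmap
  set ν := Measure.pi fun k : Fin n × Fin p =>
    bernoulliMeasure (1 : ℕ) 0 ⟨S.prob k.1 k.2, S.prob_mem k.1 k.2⟩
  let e : (Fin n × Fin p → Bool) → (Fin n × Fin p → ℕ) := fun σ k => if σ k then 1 else 0
  have he : Function.Injective e := by
    intro σ τ h
    funext k
    have := congrFun h k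
    simp only [e] at this
    cases h1 : σ k <;> cases h2 : τ k <;> simp [h1, h2] at this ⊢
  have hpt : ∀ σ, ν.real {e σ} = bernWeight S.edgeProb σ := by
    intro σ
    rw [Measure.real, ← Set.univ_pi_singleton, Measure.pi_pi, ENNReal.toReal_prod, bernWeight]
    refine Finset.prod_congr rfl fun k _ => ?_
    change (bernoulliMeasure (1 : ℕ) 0 ⟨S.prob k.1 k.2, S.prob_mem k.1 k.2⟩).real {e σ k} = _
    rw [bernoulliMeasure_real_apply _ (measurableSet_singleton _)]
    cases h : σ k <;> simp [e, h, edgeProb]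
  have hset : {ω | P fun i j => d i j ω} =
      (fun ω (k : Fin n × Fin p) => d k.1 k.2 ω) ⁻¹' {x | P fun i j => x (i, j)} := rfl
  have hmeas : AEMeasurable (fun ω (k : Fin n × Fin p) => d k.1 k.2 ω) μ := aemeasurable_pi_lambda _ hae
  have h1 : μ.real {ω | P fun i j => d i j ω} = ν.real {x | P fun i j => x (i, j)} := by
    rw [hset, Measure.real, Measure.real, ← hmap,
      Measure.map_apply_of_aemeasurable hmeas (Set.to_countable _).measurableSet]
  rw [h1]
  -- Only a lower bound on the probability is needed, so it suffices to count the finitely many 0/1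
  -- networks satisfying `P`.
  let F : Finset (Fin n × Fin p → ℕ) := (Finset.univ.filter fun σ => P (netOf σ)).image e
  have h2 : bernProb S.edgeProb {σ | P (netOf σ)} = ν.real (F : Set (Fin n × Fin p → ℕ)) := by
    rw [← sum_measureReal_singleton, Finset.sum_image he.injOn, bernProb]
    simp only [hpt, Set.mem_ofPred_eq]
  rw [h2]
  refine measureReal_mono ?_
  intro x hx
  simp only [F, Finset.coe_image, Finset.coe_filter, Finset.mem_univ, true_and, Set.mem_image] at hx
  obtain ⟨σ, hσ, rfl⟩ := hx
  exact hσ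

theorem edgeProb_nonneg (S : BlockModel n p K) (k : Fin n × Fin p) : 0 ≤ S.edgeProb k :=
  (S.prob_mem k.1 k.2).1

theorem edgeProb_le_one (S : BlockModel n p K) (k : Fin n × Fin p) : S.edgeProb k ≤ 1 :=
  (S.prob_mem k.1 k.2).2

/-- Grouping firms by type, the `θ` of each type sum to one. -/
theorem sum_prob_worker (S : BlockModel n p K) (i : Fin n) :
    ∑ j, S.prob i j = S.expWorkerDeg (S.wtype i) := by
  simp only [prob, expWorkerDeg, mul_assoc, ← Finset.mul_sum]
  congr 1
  rw [← Finset.sum_fiberwise Finset.univ S.ftype]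
  refine Finset.sum_congr rfl fun l _ => ?_
  have : ∀ j ∈ Finset.univ.filter (fun j => S.ftype j = l),
      S.θ j * S.C (S.wtype i) (S.ftype j) = S.θ j * S.C (S.wtype i) l := by
    intro j hj
    rw [(Finset.mem_filter.1 hj).2]
  rw [Finset.sum_congr rfl this, ← Finset.sum_mul, S.θ_sum l, one_mul]

/-- Grouping workers by type, the factor `1 / n_k` cancels the number of workers of type `k`. -/
theorem sum_prob_firm (S : BlockModel n p K) (j : Fin p) :
    ∑ i, S.prob i j = S.expFirmDeg j := by
  have e : ∀ i, S.prob i j =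
      S.θ j * (1 / (typeCount S.wtype (S.wtype i) : ℝ) * S.C (S.wtype i) (S.ftype j)) := by
    intro i; rw [prob]; ring
  simp only [e, expFirmDeg, ← Finset.mul_sum]
  congr 1
  rw [← Finset.sum_fiberwise Finset.univ S.wtype]
  refine Finset.sum_congr rfl fun k _ => ?_
  have : ∀ i ∈ Finset.univ.filter (fun i => S.wtype i = k),
      1 / (typeCount S.wtype (S.wtype i) : ℝ) * S.C (S.wtype i) (S.ftype j) =
        1 / (typeCount S.wtype k : ℝ) * S.C k (S.ftype j) := by
    intro i hi
    rw [(Finset.mem_filter.1 hi).2]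
  rw [Finset.sum_congr rfl this, Finset.sum_const, nsmul_eq_mul]
  have h : (typeCount S.wtype k : ℝ) ≠ 0 := by exact_mod_cast (S.typeCount_pos k).ne'
  change (typeCount S.wtype k : ℝ) * _ = _
  field_simp

theorem minDegW_le (S : BlockModel n p K) (k : Fin K) : S.minDegW ≤ S.expWorkerDeg k :=
  ciInf_le (Set.finite_range _).bddBelow k

theorem minDegF_le (S : BlockModel n p K) (j : Fin p) : S.minDegF ≤ S.expFirmDeg j :=
  ciInf_le (Set.finite_range _).bddBelow j

theorem le_maxDegW (S : BlockModel n p K) (k : Fin K) : S.expWorkerDeg k ≤ S.maxDegW :=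
  le_ciSup (Set.finite_range S.expWorkerDeg).bddAbove k

theorem le_maxDegF (S : BlockModel n p K) (j : Fin p) : S.expFirmDeg j ≤ S.maxDegF :=
  le_ciSup (Set.finite_range S.expFirmDeg).bddAbove j

end BlockModel

end Network

/-! ### Good configurations of the block model. -/

namespace BlockModel

variable {n p K : ℕ}

/-- Regularized expected degree of worker `i`. -/
def regWorkerDeg (S : BlockModel n p K) (lamw : ℝ) (i : Fin n) : ℝ :=
  S.expWorkerDeg (S.wtype i) + lamw

/-- Regularized expected degree of firm `j`. -/
def regFirmDeg (S : BlockModel n p K) (lamf : ℝ) (j : Fin p) : ℝ := S.expFirmDeg j + lamf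

theorem expElam_eq (S : BlockModel n p K) (lamw lamf : ℝ) :
    S.expElam lamw lamf = normalizedAdj (S.regWorkerDeg lamw) (S.regFirmDeg lamf) S.expAdj := rfl

/-- Configurations of edges that are close to their expectation. -/
def goodNet (S : BlockModel n p K) (lamw lamf t : ℝ) : Set (Fin n × Fin p → Bool) :=
  goodSet S.edgeProb (S.regWorkerDeg lamw) (S.regFirmDeg lamf) t

theorem expWorkerDeg_nonneg (S : BlockModel n p K) (k : Fin K) : 0 ≤ S.expWorkerDeg k :=
  mul_nonneg (by positivity) (Finset.sum_nonneg fun l _ => S.C_nonneg k l)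

theorem expFirmDeg_nonneg (S : BlockModel n p K) (j : Fin p) : 0 ≤ S.expFirmDeg j :=
  mul_nonneg (S.θ_nonneg j) (Finset.sum_nonneg fun k _ => S.C_nonneg k _)

theorem workerDeg_netOf (S : BlockModel n p K) (lamw : ℝ) (σ : Fin n × Fin p → Bool) (i : Fin n) :
    workerDeg lamw (netOf σ) i = S.regWorkerDeg lamw i + ∑ j, centered S.edgeProb σ (i, j) := by
  simp only [workerDeg, regWorkerDeg, centered, edgeProb, Finset.sum_sub_distrib,
    S.sum_prob_worker, netOf, Nat.cast_ite, Nat.cast_one, Nat.cast_zero]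
  ring

theorem firmDeg_netOf (S : BlockModel n p K) (lamf : ℝ) (σ : Fin n × Fin p → Bool) (j : Fin p) :
    firmDeg lamf (netOf σ) j = S.regFirmDeg lamf j + ∑ i, centered S.edgeProb σ (i, j) := by
  simp only [firmDeg, regFirmDeg, centered, edgeProb, Finset.sum_sub_distrib,
    S.sum_prob_firm, netOf, Nat.cast_ite, Nat.cast_one, Nat.cast_zero]
  ring

theorem adj_netOf_sub_expAdj (S : BlockModel n p K) (σ : Fin n × Fin p → Bool) :
    adj (netOf σ) - S.expAdj = Matrix.of fun i j => centered S.edgeProb σ (i, j) := by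
  ext i j
  simp [adj, netOf, expAdj, centered, edgeProb]

variable (S : BlockModel n p K) {lamw lamf t : ℝ}

theorem abs_workerDeg_sub_lt {σ : Fin n × Fin p → Bool} (hσ : σ ∈ S.goodNet lamw lamf t)
    (i : Fin n) :
    |workerDeg lamw (netOf σ) i - S.regWorkerDeg lamw i| < t * S.regWorkerDeg lamw i := by
  rw [S.workerDeg_netOf, add_sub_cancel_left]
  exact hσ.1 i

theorem abs_firmDeg_sub_lt {σ : Fin n × Fin p → Bool} (hσ : σ ∈ S.goodNet lamw lamf t)
    (j : Fin p) :
    |firmDeg lamf (netOf σ) j - S.regFirmDeg lamf j| < t * S.regFirmDeg lamf j := by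
  rw [S.firmDeg_netOf, add_sub_cancel_left]
  exact hσ.2.1 j

/-- The strict inequality in `goodSet` gives a degree strictly above `(1 - t)` times its mean, which
is positive even when `t = 1`. -/
theorem workerDeg_pos (hw : ∀ i, 0 < S.regWorkerDeg lamw i) (ht1 : t ≤ 1)
    {σ : Fin n × Fin p → Bool} (hσ : σ ∈ S.goodNet lamw lamf t) (i : Fin n) :
    0 < workerDeg lamw (netOf σ) i := by
  have h := (abs_lt.1 (S.abs_workerDeg_sub_lt hσ i)).1
  nlinarith [hw i]

theorem firmDeg_pos (hf : ∀ j, 0 < S.regFirmDeg lamf j) (ht1 : t ≤ 1)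
    {σ : Fin n × Fin p → Bool} (hσ : σ ∈ S.goodNet lamw lamf t) (j : Fin p) :
    0 < firmDeg lamf (netOf σ) j := by
  have h := (abs_lt.1 (S.abs_firmDeg_sub_lt hσ j)).1
  nlinarith [hf j]

theorem adj_nonneg (d : Fin n → Fin p → ℕ) (i : Fin n) (j : Fin p) : 0 ≤ adj d i j :=
  Nat.cast_nonneg _

theorem lam_le_maxDegF (hp : 0 < p) : lamf ≤ S.maxDegF + lamf := by
  linarith [S.expFirmDeg_nonneg ⟨0, hp⟩, S.le_maxDegF ⟨0, hp⟩]

theorem lam_le_maxDegW (hn : 0 < n) : lamw ≤ S.maxDegW + lamw := by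
  linarith [S.expWorkerDeg_nonneg (S.wtype ⟨0, hn⟩), S.le_maxDegW (S.wtype ⟨0, hn⟩)]

theorem isUnit_expLf (hp : 0 < p) (hlamw : 0 ≤ lamw) (hw : ∀ i, 0 < S.regWorkerDeg lamw i)
    (hf : ∀ j, 0 < S.regFirmDeg lamf j) (hl : 0 < lamf) : IsUnit (S.expLf lamw lamf) := by
  refine (firmLaplacian_isUnit_and_norm_inv_le (B := S.expAdj) hw hf
    (fun i j => (S.prob_mem i j).1) (fun i => ?_) hl (S.lam_le_maxDegF hp) (fun j => ?_)
    fun j => add_le_add_left (S.le_maxDegF j) _).2.1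
  · simp only [expAdj, Matrix.of_apply, S.sum_prob_worker, regWorkerDeg]
    linarith
  · simp only [expAdj, Matrix.of_apply, S.sum_prob_firm, regFirmDeg]
    linarith

theorem isUnit_expLw (hn : 0 < n) (hlamf : 0 ≤ lamf) (hw : ∀ i, 0 < S.regWorkerDeg lamw i)
    (hf : ∀ j, 0 < S.regFirmDeg lamf j) (hl : 0 < lamw) : IsUnit (S.expLw lamw lamf) := by
  rw [expLw, expElam_eq, workerLaplacian_normalizedAdj]
  refine (firmLaplacian_isUnit_and_norm_inv_le (B := S.expAdj.transpose) hf hw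
    (fun j i => (S.prob_mem i j).1) (fun j => ?_) hl (S.lam_le_maxDegW hn) (fun i => ?_)
    fun i => add_le_add_left (S.le_maxDegW _) _).2.1
  · simp only [expAdj, Matrix.transpose_apply, Matrix.of_apply, S.sum_prob_firm, regFirmDeg]
    linarith
  · simp only [expAdj, Matrix.transpose_apply, Matrix.of_apply, S.sum_prob_worker, regWorkerDeg]
    linarith

theorem Lf_inv_sub_le (hp : 0 < p) (hlamw : 0 ≤ lamw) (hw : ∀ i, 0 < S.regWorkerDeg lamw i)
    (hf : ∀ j, 0 < S.regFirmDeg lamf j) (hl : 0 < lamf) (ht : 0 ≤ t) (ht1 : t ≤ 1)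
    {σ : Fin n × Fin p → Bool} (hσ : σ ∈ S.goodNet lamw lamf t) :
    IsUnit (Lf lamw lamf (netOf σ)) ∧
      ‖(Lf lamw lamf (netOf σ))⁻¹ - (S.expLf lamw lamf)⁻¹‖ ≤
        16 * t * ((S.maxDegF + lamf) / lamf) ^ 2 := by
  refine norm_firmLaplacian_inv_sub_le (B := adj (netOf σ)) (C := S.expAdj) hw hf
    (S.workerDeg_pos hw ht1 hσ) (S.firmDeg_pos hf ht1 hσ) (adj_nonneg _)
    (fun i j => (S.prob_mem i j).1) (fun i => ?_) (fun i => ?_) hl (S.lam_le_maxDegF hp)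
    (fun j => ?_) (fun j => ?_) (fun j => add_le_add_left (S.le_maxDegF j) _) ht ht1
    (fun i => (S.abs_workerDeg_sub_lt hσ i).le) (fun j => (S.abs_firmDeg_sub_lt hσ j).le)
    fun h => ?_
  · simp only [adj, Matrix.of_apply, workerDeg]
    linarith
  · simp only [expAdj, Matrix.of_apply, S.sum_prob_worker, regWorkerDeg]
    linarith
  · simp only [adj, Matrix.of_apply, firmDeg]
    linarith
  · simp only [expAdj, Matrix.of_apply, S.sum_prob_firm, regFirmDeg]
    linarith
  · rw [S.adj_netOf_sub_expAdj]
    exact hσ.2.2 h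

/-- Transposing the network exchanges workers and firms, so the firm-side perturbation bound applies
on the same good event. -/
theorem Lw_inv_sub_le (hn : 0 < n) (hlamf : 0 ≤ lamf) (hw : ∀ i, 0 < S.regWorkerDeg lamw i)
    (hf : ∀ j, 0 < S.regFirmDeg lamf j) (hl : 0 < lamw) (ht : 0 ≤ t) (ht1 : t ≤ 1)
    {σ : Fin n × Fin p → Bool} (hσ : σ ∈ S.goodNet lamw lamf t) :
    IsUnit (Lw lamw lamf (netOf σ)) ∧
      ‖(Lw lamw lamf (netOf σ))⁻¹ - (S.expLw lamw lamf)⁻¹‖ ≤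
        16 * t * ((S.maxDegW + lamw) / lamw) ^ 2 := by
  rw [Lw, Elam, workerLaplacian_normalizedAdj, expLw, expElam_eq, workerLaplacian_normalizedAdj]
  refine norm_firmLaplacian_inv_sub_le (B := (adj (netOf σ)).transpose)
    (C := S.expAdj.transpose) hf hw
    (S.firmDeg_pos hf ht1 hσ) (S.workerDeg_pos hw ht1 hσ) (fun j i => adj_nonneg _ i j)
    (fun j i => (S.prob_mem i j).1) (fun j => ?_) (fun j => ?_) hl (S.lam_le_maxDegW hn)
    (fun i => ?_) (fun i => ?_) (fun i => add_le_add_left (S.le_maxDegW _) _) ht ht1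
    (fun j => (S.abs_firmDeg_sub_lt hσ j).le) (fun i => (S.abs_workerDeg_sub_lt hσ i).le)
    fun h => ?_
  · simp only [adj, Matrix.transpose_apply, Matrix.of_apply, firmDeg]
    linarith
  · simp only [expAdj, Matrix.transpose_apply, Matrix.of_apply, S.sum_prob_firm, regFirmDeg]
    linarith
  · simp only [adj, Matrix.transpose_apply, Matrix.of_apply, workerDeg]
    linarith
  · simp only [expAdj, Matrix.transpose_apply, Matrix.of_apply, S.sum_prob_worker, regWorkerDeg]
    linarith
  · rw [← Matrix.transpose_sub, S.adj_netOf_sub_expAdj, ← normalizedAdj_transpose, norm_transpose]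
    exact hσ.2.2 h

theorem one_sub_le_bernProb_goodNet (hlamw : 0 ≤ lamw) (hlamf : 0 ≤ lamf)
    (hw : 0 < S.minDegW + lamw) (hf : 0 < S.minDegF + lamf) (hn : 0 < n) {ε : ℝ} (hε : 0 < ε)
    (ht : 0 < S.t lamw lamf ε) (ht1 : S.t lamw lamf ε ≤ 1) :
    1 - 3 * ε ≤ bernProb S.edgeProb (S.goodNet lamw lamf (S.t lamw lamf ε)) := by
  have hα : ∀ i, S.minDegW + lamw ≤ S.regWorkerDeg lamw i := fun i =>
    add_le_add_left (S.minDegW_le _) _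
  have hβ : ∀ j, S.minDegF + lamf ≤ S.regFirmDeg lamf j := fun j =>
    add_le_add_left (S.minDegF_le _) _
  have hM : 0 < S.M lamw lamf := lt_max_of_lt_left (inv_pos.2 hf)
  have h := bernProb_compl_goodSet_le S.edgeProb_nonneg S.edgeProb_le_one
    (fun i => hw.trans_le (hα i)) (fun j => hf.trans_le (hβ j))
    (fun i => by
      change ∑ j, S.prob i j ≤ _
      rw [S.sum_prob_worker, regWorkerDeg]
      linarith)
    (fun j => by
      change ∑ i, S.prob i j ≤ _
      rw [S.sum_prob_firm, regFirmDeg]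
      linarith) hM
    (fun i => (inv_anti₀ hw (hα i)).trans (le_max_right _ _))
    (fun j => (inv_anti₀ hf (hβ j)).trans (le_max_left _ _)) ht ht1
  have hnp : 0 < (n : ℝ) + p := by positivity
  have e : ((n : ℝ) + p) * Real.exp (-(S.t lamw lamf ε ^ 2 / (3 * S.M lamw lamf))) = ε := by
    rw [t, Real.sq_sqrt (Real.sqrt_pos.1 ht).le, mul_div_cancel_left₀ _ (by positivity),
      Real.exp_neg, Real.exp_log (by positivity)]
    field_simp
  rw [e] at h
  rw [bernProb_compl]
  linarith [show bernProb S.edgeProb (S.goodNet lamw lamf (S.t lamw lamf ε))ᶜ ≤ 3 * ε from h]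

theorem t_pos_and_le_one (hf : 0 < S.minDegF + lamf) {ε : ℝ}
    (hM : S.M lamw lamf ≤ (3 * Real.log (((n : ℝ) + p) / ε))⁻¹) :
    0 < S.t lamw lamf ε ∧ S.t lamw lamf ε ≤ 1 := by
  have hM0 : 0 < S.M lamw lamf := lt_max_of_lt_left (inv_pos.2 hf)
  -- Positivity of `M` forces the inverse, hence the logarithm, to be positive, which excludes the
  -- default value of division by zero.
  have hL : 0 < 3 * Real.log (((n : ℝ) + p) / ε) := inv_pos.1 (hM0.trans_le hM)
  have h1 : 3 * S.M lamw lamf * Real.log (((n : ℝ) + p) / ε) ≤ 1 := by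
    have := mul_le_mul_of_nonneg_right hM hL.le
    rw [inv_mul_cancel₀ hL.ne'] at this
    linarith
  refine ⟨Real.sqrt_pos.2 ?_, Real.sqrt_le_one.2 h1⟩
  have := mul_pos hM0 hL
  linarith

end BlockModel

end TwoWay

end

theorem mainTheorem2 {n p K : ℕ} (hn : 0 < n) (hp : 0 < p) (S : TwoWay.BlockModel n p K)
    {Ω : Type*} [MeasurableSpace Ω] (μ : Measure Ω) [IsProbabilityMeasure μ]
    (d : Fin n → Fin p → Ω → ℕ) (hd : S.IsNetwork μ d)
    (lamw lamf : ℝ) (hlamw : 0 ≤ lamw) (hlamf : 0 ≤ lamf)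
    (hw : 0 < S.minDegW + lamw) (hf : 0 < S.minDegF + lamf)
    (ε : ℝ) (hε : 0 < ε)
    (hM : S.M lamw lamf ≤ (3 * Real.log (((n : ℝ) + p) / ε))⁻¹)
    (γ : ℝ) (hγ : γ = (p : ℝ) / n) :
    (0 < lamf →
      IsUnit (S.expLf lamw lamf) ∧
      1 - (3 + 5 * γ) / (1 + γ) * ε ≤ μ.real {ω |
        (∀ i, 0 < TwoWay.workerDeg lamw (fun i j => d i j ω) i) ∧
        (∀ j, 0 < TwoWay.firmDeg lamf (fun i j => d i j ω) j) ∧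
        IsUnit (TwoWay.Lf lamw lamf (fun i j => d i j ω)) ∧
        ‖(TwoWay.Lf lamw lamf (fun i j => d i j ω))⁻¹ - (S.expLf lamw lamf)⁻¹‖ ≤
          16 * S.t lamw lamf ε * ((S.maxDegF + lamf) / lamf) ^ 2}) ∧
    (0 < lamw →
      IsUnit (S.expLw lamw lamf) ∧
      1 - 4 * ε ≤ μ.real {ω |
        (∀ i, 0 < TwoWay.workerDeg lamw (fun i j => d i j ω) i) ∧
        (∀ j, 0 < TwoWay.firmDeg lamf (fun i j => d i j ω) j) ∧
        IsUnit (TwoWay.Lw lamw lamf (fun i j => d i j ω)) ∧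
        ‖(TwoWay.Lw lamw lamf (fun i j => d i j ω))⁻¹ - (S.expLw lamw lamf)⁻¹‖ ≤
          16 * S.t lamw lamf ε * ((S.maxDegW + lamw) / lamw) ^ 2}) := by
  obtain ⟨ht, ht1⟩ := S.t_pos_and_le_one hf hM
  have hα : ∀ i, 0 < S.regWorkerDeg lamw i := fun i =>
    hw.trans_le (add_le_add_left (S.minDegW_le _) _)
  have hβ : ∀ j, 0 < S.regFirmDeg lamf j := fun j =>
    hf.trans_le (add_le_add_left (S.minDegF_le _) _)
  have hgood := S.one_sub_le_bernProb_goodNet hlamw hlamf hw hf hn hε ht ht1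
  refine ⟨fun hl => ⟨S.isUnit_expLf hp hlamw hα hβ hl, ?_⟩,
    fun hl => ⟨S.isUnit_expLw hn hlamf hα hβ hl, ?_⟩⟩
  · have hγ0 : 0 ≤ γ := by rw [hγ]; positivity
    -- The good event already has probability at least `1 - 3ε`, and `3 (1 + γ) ≤ 3 + 5γ`.
    have h3 : 3 * ε ≤ (3 + 5 * γ) / (1 + γ) * ε := by
      refine mul_le_mul_of_nonneg_right ?_ hε.le
      rw [le_div_iff₀ (by linarith)]
      linarith
    have h := S.bernProb_le_measureReal μ hd fun N =>
      (∀ i, 0 < TwoWay.workerDeg lamw N i) ∧ (∀ j, 0 < TwoWay.firmDeg lamf N j) ∧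
        IsUnit (TwoWay.Lf lamw lamf N) ∧
        ‖(TwoWay.Lf lamw lamf N)⁻¹ - (S.expLf lamw lamf)⁻¹‖ ≤
          16 * S.t lamw lamf ε * ((S.maxDegF + lamf) / lamf) ^ 2
    refine le_trans (le_trans (by linarith) (hgood.trans ?_)) h
    exact TwoWay.bernProb_mono S.edgeProb_nonneg S.edgeProb_le_one fun σ hσ =>
      ⟨S.workerDeg_pos hα ht1 hσ, S.firmDeg_pos hβ ht1 hσ,
        S.Lf_inv_sub_le hp hlamw hα hβ hl ht.le ht1 hσ⟩
  · have h := S.bernProb_le_measureReal μ hd fun N =>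
      (∀ i, 0 < TwoWay.workerDeg lamw N i) ∧ (∀ j, 0 < TwoWay.firmDeg lamf N j) ∧
        IsUnit (TwoWay.Lw lamw lamf N) ∧
        ‖(TwoWay.Lw lamw lamf N)⁻¹ - (S.expLw lamw lamf)⁻¹‖ ≤
          16 * S.t lamw lamf ε * ((S.maxDegW + lamw) / lamw) ^ 2
    refine le_trans (le_trans (by linarith) (hgood.trans ?_)) h
    exact TwoWay.bernProb_mono S.edgeProb_nonneg S.edgeProb_le_one fun σ hσ =>
      ⟨S.workerDeg_pos hα ht1 hσ, S.firmDeg_pos hβ ht1 hσ,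
        S.Lw_inv_sub_le hn hlamf hα hβ hl ht.le ht1 hσ⟩
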